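/- **Conventions.** Number the rows and columns of a Young diagram from the top left corner. The box in row $i$ and column $j$ lies on the diagonal $D_{j-i}$. A domino of a paving contains exactly one box on a diagonal of even index $2k$; we say that the domino lies on $D_{2k}$. It has *type 1* if its other box lies on $D_{2k-1}$ and *type 2* if its other box lies on $D_{2k+1}$. A domino $F_2$ is *weakly southeast* of a domino $F_1$ if some box of $F_2$ lies in a row weakly below and a column weakly to the right of the top left box of $F_1$. The alphabet consists of the primed and unprimed positive integers, ordered by $1'<1<2'<2<\cdots$. For finite non-empty sets $A,B$ of letters, $A\le B$ means $\max A\le\min B$. **2-quotient.** Let $\lambda=(\lambda_1,\dots,\lambda_k)$ be a partition with $k$ (positive) parts, and put $l_i=\lambda_i+k-i$. From the even (respectively odd) $l_i$, taken from right to left, subtract $0,2,4,\dots$ (respectively $1,3,5,\dots$), divide by $2$ and delete zeros. This gives $\mu$ (respectively $\nu$), and $(\mu,\nu)$ is the 2-quotient of $\lambda$. **Shifted pavings.** A paving of $\lambda$ by dominoes is *shifted* if * each of $\mu$ and $\nu$ is empty or has last part at least its number of parts, and * there is no vertical domino $d$ on $D_0$ such that dominoes directly left of and adjacent to $d$ exist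 and all of them lie strictly southwest of $D_0$ (that is, on some $D_{2k}$ with $k<0$). The partition $\lambda$ is *shifted pavable* if it has a shifted paving. **Tableaux.** A *shifted set-valued tableau* of shape $\mu$ is a filling of the boxes of $\mu$ on the diagonals $D_k$, $k<0$, with the symbol $X$ and of the other boxes with finite non-empty sets of letters, such that entries weakly increase along rows and down columns, each unprimed letter $i$ occurs in at most one box of each column, and each primed letter $i'$ occurs in at most one box of each row. A *shifted domino tableau* is a shifted paving whose dominoes on $D_{2k}$, $k<0$, are filled with $X$ and whose other dominoes are filled with single letters, such that rows and columns weakly increase, each unprimed $i$ occurs in at most one domino meeting a given column, and each $i'$ occurs in at most one domino meeting a given row. A *shifted set-valued domino tableau* $T$ of shape $\lambda$ is a shifted paving of $\lambda$ whose dominoes on $D_{2k}$, $k<0$, are filled with $X$ and whose other dominoes are filled with finite non-empty sets of letters, such that 1. replacing every set by its minimum gives a shifted domino tableau; 2. if $F_1,F_2$ are dominoes filled with sets, of the same type, on neighbouring diagonals, and $F_2$ is weakly southeast of $F_1$, then $\max F_1\le\min F_2$. Moreover $\max F_1<\min F_2$ if $F_1$ is on some $D_{2k}$, $F_2$ is on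 $D_{2(k+1)}$ and $\max F_1$ is primed, and also if $F_1$ is on $D_{2(k+1)}$, $F_2$ is on $D_{2k}$ and $\max F_1$ is unprimed. Its up-part $up(T)$ is the set of its dominoes on the $D_{2k}$ with $k\ge 0$, together with their entries. Two such tableaux $T,T'$, possibly with different pavings, are equivalent if $up(T)=up(T')$. **Theorem.** Let $\lambda$ be a shifted pavable partition with 2-quotient $(\mu,\nu)$. There is a bijection $\Gamma$ from the set of equivalence classes of shifted set-valued domino tableaux of shape $\lambda$ onto the set of pairs $(t_1,t_2)$ where $t_1$ is a shifted set-valued tableau of shape $\mu$ and $t_2$ is a shifted set-valued tableau of shape $\nu$. It has the following property. Let $(t_1,t_2)$ be the image of the class of $T$, and let $k\ge0$. The entries of $T$ on the dominoes of one type on $D_{2k}$, read from northwest to southeast, are the entries of $t_1$ on $D_k$, read from northwest to southeast, and the entries of $T$ on the dominoes of the other type on $D_{2k}$, read in the same way, are those of $t_2$ on $D_k$. Here $t_1$ corresponds to type 1 and $t_2$ to type 2 if $\lambda$ has an even number of parts, and $t_1$ corresponds to type 2 and $t_2$ to type 1 if $\lambda$ has an odd number of parts. -/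

import Mathlib

/-! Partitions are Mathlib's `YoungDiagram`s (English convention). A box in row `i` and column `j`,
counted from `0`, is the pair `(i, j)`; it lies on the diagonal `D_k` with `k = j - i`. -/

namespace ShiftedDomino

/-- The index `k` of the diagonal `D_k` through a box. -/
def content (c : ℕ × ℕ) : ℤ := (c.2 : ℤ) - (c.1 : ℤ)

/-! ### The alphabet `1' < 1 < 2' < 2 < ⋯` and its finite non-empty subsets -/

/-- Primed and unprimed positive integers: `(i, false)` is `i'` and `(i, true)` is `i`, in
lexicographic order, so that `1' < 1 < 2' < 2 < ⋯`. -/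
abbrev Letter : Type := ℕ+ ×ₗ Bool

/-- The letter is some `i'`. -/
def Letter.IsPrimed (x : Letter) : Prop := (ofLex x).2 = false

/-- Finite non-empty sets of letters. -/
abbrev SetEntry : Type := {A : Finset Letter // A.Nonempty}

/-- The largest letter of an entry. -/
def SetEntry.maxLetter (A : SetEntry) : Letter := A.1.max' A.2

/-- The smallest letter of an entry. -/
def SetEntry.minLetter (A : SetEntry) : Letter := A.1.min' A.2

/-! ### Shifted set-valued tableaux -/

/-- A shifted set-valued tableau of shape `μ`. The value `some A` on a box means that the box is
filled with `A`; the boxes of `μ` strictly southwest of `D_0`, which carry the symbol `X`, and the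
positions outside `μ` have the value `none`. Sets are compared by
`A ≤ B ↔ max A ≤ min B`. -/
@[ext] structure ShiftedSetTableau (μ : YoungDiagram) where
  fill : ℕ × ℕ → Option SetEntry
  fill_isSome_iff : ∀ c, (fill c).isSome ↔ c ∈ μ ∧ 0 ≤ content c
  row_weak : ∀ i j j' A B, j < j' → fill (i, j) = some A → fill (i, j') = some B →
    A.maxLetter ≤ B.minLetter
  col_weak : ∀ i i' j A B, i < i' → fill (i, j) = some A → fill (i', j) = some B →
    A.maxLetter ≤ B.minLetter
  col_unprimed : ∀ i i' j A B (x : Letter), fill (i, j) = some A → fill (i', j) = some B →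
    ¬ x.IsPrimed → x ∈ A.1 → x ∈ B.1 → i = i'
  row_primed : ∀ i j j' A B (x : Letter), fill (i, j) = some A → fill (i, j') = some B →
    x.IsPrimed → x ∈ A.1 → x ∈ B.1 → j = j'

/-- The segment of the diagonal reading word on `D_k`, for `k ≥ 0`: the entries on `D_k`, read from
northwest to southeast. -/
def ShiftedSetTableau.diagonalWord {μ : YoungDiagram} (t : ShiftedSetTableau μ) (k : ℕ) :
    List SetEntry :=
  (List.range (μ.colLen 0)).filterMap fun i => t.fill (i, i + k)

/-! ### Dominoes and pavings -/

/-- A horizontal or vertical domino, given by the position of its top left box. -/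
inductive Domino : Type
  | horiz (i j : ℕ) : Domino
  | vert (i j : ℕ) : Domino

namespace Domino

/-- The top left box of a domino. -/
def topLeft : Domino → ℕ × ℕ
  | horiz i j => (i, j)
  | vert i j => (i, j)

/-- The other box of a domino. -/
def bottomRight : Domino → ℕ × ℕ
  | horiz i j => (i, j + 1)
  | vert i j => (i + 1, j)

/-- The two boxes of a domino. -/
def cells (d : Domino) : Finset (ℕ × ℕ) := {d.topLeft, d.bottomRight}

/-- The domino is vertical. -/
def IsVertical : Domino → Prop
  | horiz _ _ => False
  | vert _ _ => True

/-- The box of a domino that lies on a diagonal of even index. -/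
def evenCell (d : Domino) : ℕ × ℕ :=
  if content d.topLeft % 2 = 0 then d.topLeft else d.bottomRight

/-- The box of a domino that lies on a diagonal of odd index. -/
def oddCell (d : Domino) : ℕ × ℕ :=
  if content d.topLeft % 2 = 0 then d.bottomRight else d.topLeft

/-- The `k` for which `D_{2k}` is the unique diagonal of even index that crosses the domino. -/
def diagonal (d : Domino) : ℤ := content d.evenCell / 2

end Domino

/-- The two types of dominoes. -/
inductive DominoType : Type
  | one : DominoType
  | two : DominoType

/-- A domino crossed by `D_{2k}` has type 1 if its other box lies southwest of that diagonal, on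
`D_{2k-1}` (so that the small triangle cut off by the diagonal points upward), and type 2 if its
other box lies on `D_{2k+1}` (so that the small triangle points downward). -/
def Domino.type (d : Domino) : DominoType :=
  if content d.oddCell < content d.evenCell then DominoType.one else DominoType.two

/-- `F₂` is weakly southeast of `F₁`: some box of `F₂` is weakly southeast of the top left box
of `F₁`. -/
def WeaklySoutheast (F₂ F₁ : Domino) : Prop :=
  ∃ c ∈ F₂.cells, F₁.topLeft.1 ≤ c.1 ∧ F₁.topLeft.2 ≤ c.2

/-- `e` is directly left of `d` and adjacent to it. -/
def LeftAdjacent (e d : Domino) : Prop :=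
  ∃ c ∈ e.cells, ∃ b ∈ d.cells, c.1 = b.1 ∧ c.2 + 1 = b.2

/-- `P` is a domino paving of `lam`. -/
def IsPaving (lam : YoungDiagram) (P : Finset Domino) : Prop :=
  (∀ d ∈ P, d.cells ⊆ lam.cells) ∧ ∀ c ∈ lam.cells, ∃! d, d ∈ P ∧ c ∈ d.cells

/-! ### The 2-quotient -/

/-- The sequence `L` with `l_i = λ_i + k - i` for `λ = (λ_1, …, λ_k)` (the index of the list
starts at `0`). -/
def betaNumbers (l : List ℕ) : List ℕ := l.mapIdx fun i x => x + (l.length - 1 - i)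

/-- From the components of `L` that are congruent to `r` modulo `2` subtract, from right to left,
`r, r + 2, r + 4, …`, divide by `2`, and delete the zeros. The 2-quotient `(μ, ν)` of `λ` is given
by `μ` for `r = 0` and `ν` for `r = 1`. -/
def quotientPart (r : ℕ) (l : List ℕ) : List ℕ :=
  let E := (betaNumbers l).filter fun x => x % 2 = r
  (E.mapIdx fun i x => (x - (2 * (E.length - 1 - i) + r)) / 2).filter fun x => 0 < x

/-- `(μ, ν)` is the 2-quotient of `lam`; `rowLens` is the list of the (positive) parts. -/
def IsTwoQuotient (lam μ ν : YoungDiagram) : Prop :=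
  μ.rowLens = quotientPart 0 lam.rowLens ∧ ν.rowLens = quotientPart 1 lam.rowLens

/-! ### Shifted pavings and shifted set-valued domino tableaux -/

/-- The condition `λ_k ≥ k` on `(λ_1, …, λ_k)`; it is void for the empty partition. -/
def LastPartLarge (l : List ℕ) : Prop := ∀ x ∈ l.getLast?, l.length ≤ x

/-- `P` is a shifted paving of `lam`: a paving such that both partitions of the 2-quotient have
last part at least their number of parts, and there is no vertical domino on `D_0` that has left
neighbours, all of them strictly below `D_0`. -/
structure IsShiftedPaving (lam : YoungDiagram) (P : Finset Domino) : Prop where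
  paving : IsPaving lam P
  last_fst : LastPartLarge (quotientPart 0 lam.rowLens)
  last_snd : LastPartLarge (quotientPart 1 lam.rowLens)
  no_bad_vertical : ¬ ∃ d ∈ P, d.IsVertical ∧ d.diagonal = 0 ∧
    (∃ e ∈ P, LeftAdjacent e d) ∧ ∀ e ∈ P, LeftAdjacent e d → e.diagonal < 0

/-- `lam` is a shifted pavable partition. -/
def IsShiftedPavable (lam : YoungDiagram) : Prop := ∃ P, IsShiftedPaving lam P

/-- The paving `P` filled by `f` is a shifted domino tableau. The dominoes strictly below `D_0`,
which carry the symbol `X`, and the dominoes that are not in `P` have the value `none`. -/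
structure IsShiftedDominoTableau (P : Finset Domino) (f : Domino → Option Letter) : Prop where
  isSome_iff : ∀ d, (f d).isSome ↔ d ∈ P ∧ 0 ≤ d.diagonal
  row_weak : ∀ d e x y, f d = some x → f e = some y →
    (∃ b ∈ d.cells, ∃ c ∈ e.cells, b.1 = c.1 ∧ b.2 < c.2) → x ≤ y
  col_weak : ∀ d e x y, f d = some x → f e = some y →
    (∃ b ∈ d.cells, ∃ c ∈ e.cells, b.2 = c.2 ∧ b.1 < c.1) → x ≤ y
  col_unprimed : ∀ d e x, f d = some x → f e = some x → ¬ x.IsPrimed →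
    (∃ b ∈ d.cells, ∃ c ∈ e.cells, b.2 = c.2) → d = e
  row_primed : ∀ d e x, f d = some x → f e = some x → x.IsPrimed →
    (∃ b ∈ d.cells, ∃ c ∈ e.cells, b.1 = c.1) → d = e

/-- A shifted set-valued domino tableau of shape `lam`: a shifted paving with a filling of the
dominoes on `D_{2k}`, `k ≥ 0`, by finite non-empty sets of letters (`none` stands for the symbol
`X` on the dominoes of the paving strictly below `D_0`, and is the value off the paving). -/
structure ShiftedSetDominoTableau (lam : YoungDiagram) where
  paving : Finset Domino
  isShiftedPaving : IsShiftedPaving lam paving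
  fill : Domino → Option SetEntry
  min_tableau : IsShiftedDominoTableau paving fun d => (fill d).map SetEntry.minLetter
  east : ∀ F₁ F₂ A B, fill F₁ = some A → fill F₂ = some B → F₁.type = F₂.type →
    WeaklySoutheast F₂ F₁ → F₂.diagonal = F₁.diagonal + 1 →
    A.maxLetter ≤ B.minLetter ∧ (A.maxLetter.IsPrimed → A.maxLetter < B.minLetter)
  south : ∀ F₁ F₂ A B, fill F₁ = some A → fill F₂ = some B → F₁.type = F₂.type →
    WeaklySoutheast F₂ F₁ → F₁.diagonal = F₂.diagonal + 1 →
    A.maxLetter ≤ B.minLetter ∧ (¬ A.maxLetter.IsPrimed → A.maxLetter < B.minLetter)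

namespace ShiftedSetDominoTableau

variable {lam : YoungDiagram}

/-- `up(T)`: the dominoes weakly northeast of `D_0`, together with their entries. -/
def up (T : ShiftedSetDominoTableau lam) : Set (Domino × SetEntry) :=
  {p | p.1 ∈ T.paving ∧ 0 ≤ p.1.diagonal ∧ T.fill p.1 = some p.2}

/-- `w` is the segment on `D_{2k}`, `k ≥ 0`, of the diagonal reading word of `T` restricted to the
dominoes of type `τ`: the entries of these dominoes, read from northwest to southeast. -/
def IsDiagonalWord (T : ShiftedSetDominoTableau lam) (τ : DominoType) (k : ℕ)
    (w : List SetEntry) : Prop :=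
  ∃ ds : List Domino, ds.Pairwise (fun d e => d.evenCell.1 < e.evenCell.1) ∧
    (∀ d, d ∈ ds ↔ d ∈ T.paving ∧ d.type = τ ∧ d.diagonal = (k : ℤ)) ∧
    ds.map T.fill = w.map some

end ShiftedSetDominoTableau

/-- Two shifted set-valued domino tableaux are equivalent if they have the same up-part. -/
def upSetoid (lam : YoungDiagram) : Setoid (ShiftedSetDominoTableau lam) where
  r T T' := T.up = T'.up
  iseqv := ⟨fun _ => rfl, fun h => h.symm, fun h h' => h.trans h'⟩

/-- The type of the dominoes that correspond to the first partition `μ` of the 2-quotient. As `L`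
is formed with the number of parts, it is type 1 if this number is even and type 2 if it is odd. -/
def fstType (lam : YoungDiagram) : DominoType :=
  if lam.rowLens.length % 2 = 0 then DominoType.one else DominoType.two

/-- The type of the dominoes that correspond to the second partition `ν` of the 2-quotient. -/
def sndType (lam : YoungDiagram) : DominoType :=
  if lam.rowLens.length % 2 = 0 then DominoType.two else DominoType.one

end ShiftedDomino

/-! A domino is described by its station, the larger one of the indices of the two diagonals that it
meets: dominoes of type 1 on `D_{2k}` have station `2k`, and those of type 2 have station `2k + 1`.
The diagonal `D_j` is covered by the dominoes of the stations `j` and `j + 1`. A pair of shifted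
set-valued tableaux is the same as a family of entries `w m i`, indexed by a station `m ≥ 0` and
a number `i`, such that the stations `m` and `m + 2`, which are neighbouring diagonals of one of the
two tableaux, satisfy the conditions for horizontal and vertical neighbours
(`IsDiagonalSystem`).

The lengths agree: since `D_j` has as many boxes as there are dominoes of the stations `j` and
`j + 1`, the number of dominoes of each station `m ≥ 0` is the same for all pavings, and in terms of
beta numbers it is the length of a diagonal of the 2-quotient (`IsPaving.stationCount_eq`,
`IsPaving.diagLen_quotient`). The existence of a paving makes even and odd beta numbers balanced.

For the positions, every entry gets a key, its smallest letter together with its station, where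
equal unprimed letters are ordered by increasing and equal primed letters by decreasing station.
In both kinds of tableaux keys increase strictly from one box or domino to a different one on the
right or below. Two sequences interlace if and only if their counting functions
`#{keys < κ}` differ by `0` or `1`; adding the counts of the station `m + 1` to those of the
stations `m` and `m + 2` does not change the difference, so the diagonals `D_m` and `D_{m+1}` of the
domino tableau interlace if and only if the stations `m` and `m + 2` do. Hence a domino must occupy
the boxes whose positions on its two diagonals are the ranks of its key there, and conversely these
two boxes always form a domino (`nodeDomino`). On `D_{-1}`, where the dominoes of station `1` are
missing, the position is fixed by the condition on vertical dominoes: a domino of station `0` is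
vertical if and only if no domino of station `1` precedes it on `D_0`
(`ShiftedSetDominoTableau.lo_row_of_station_zero`). So the up-part of a tableau and its diagonal
system determine each other (`ShiftedSetDominoTableau.exists_system`, `eq_of_systemUp_eq`).

It remains to pave the boxes strictly below `D_0` that are left over. Only the number of boxes that
the filled dominoes occupy on `D_{-1}` matters, and it is the same as in the given paving, so
a paving is built diagonal by diagonal (`IsPaving.exists_paving_below`). Therefore every diagonal
system comes from a tableau (`IsDiagonalSystem.exists_tableau`). -/

namespace ShiftedDomino

/-! ### Keys of entries -/

/-- The key of a letter `x` placed at position `m`: letters come first, and equal letters are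
compared by increasing position if they are unprimed and by decreasing position if they are primed.
This is the standardization order of the theory of shifted tableaux. -/
noncomputable def key (x : Letter) (m : ℤ) : Letter ×ₗ ℤ :=
  open Classical in toLex (x, if x.IsPrimed then -m else m)

theorem key_lt_key_iff {x y : Letter} {m m' : ℤ} :
    key x m < key y m' ↔
      x < y ∨ x = y ∧ ((x.IsPrimed → m' < m) ∧ (¬ x.IsPrimed → m < m')) := by
  classical
  unfold key
  rw [Prod.Lex.toLex_lt_toLex]
  refine or_congr Iff.rfl (and_congr_right fun h => ?_)
  obtain rfl : x = y := h
  by_cases hp : x.IsPrimed <;> simp [hp]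

theorem key_inj {x y : Letter} {m m' : ℤ} : key x m = key y m' ↔ x = y ∧ m = m' := by
  classical
  unfold key
  constructor
  · intro h
    have h1 := congrArg (fun z => (ofLex z).1) h
    have h2 := congrArg (fun z => (ofLex z).2) h
    obtain rfl : x = y := h1
    refine ⟨rfl, ?_⟩
    by_cases hp : x.IsPrimed <;> simpa [hp] using h2
  · rintro ⟨rfl, rfl⟩; rfl

theorem key_le_key_iff {x y : Letter} {m m' : ℤ} :
    key x m ≤ key y m' ↔
      x < y ∨ x = y ∧ ((x.IsPrimed → m' ≤ m) ∧ (¬ x.IsPrimed → m ≤ m')) := by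
  rw [le_iff_lt_or_eq, key_lt_key_iff, key_inj]
  constructor
  · rintro ((h | ⟨h, h1, h2⟩) | ⟨h, rfl⟩)
    · exact Or.inl h
    · exact Or.inr ⟨h, fun hp => (h1 hp).le, fun hp => (h2 hp).le⟩
    · exact Or.inr ⟨h, fun _ => le_rfl, fun _ => le_rfl⟩
  · rintro (h | ⟨h, h1, h2⟩)
    · exact Or.inl (Or.inl h)
    · by_cases hm : m = m'
      · exact Or.inr ⟨h, hm⟩
      · exact Or.inl (Or.inr ⟨h, fun hp => lt_of_le_of_ne (h1 hp) (Ne.symm hm),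
          fun hp => lt_of_le_of_ne (h2 hp) hm⟩)

theorem SetEntry.minLetter_le_maxLetter (A : SetEntry) : A.minLetter ≤ A.maxLetter :=
  Finset.min'_le _ _ (Finset.max'_mem _ _)

theorem SetEntry.le_maxLetter {A : SetEntry} {x : Letter} (h : x ∈ A.1) : x ≤ A.maxLetter :=
  Finset.le_max' _ _ h

theorem SetEntry.minLetter_le {A : SetEntry} {x : Letter} (h : x ∈ A.1) : A.minLetter ≤ x :=
  Finset.min'_le _ _ h

/-- The condition on an entry `A` and the entry `B` to the right of it. -/
def EastOK (A B : SetEntry) : Prop :=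
  A.maxLetter ≤ B.minLetter ∧ (A.maxLetter.IsPrimed → A.maxLetter < B.minLetter)

/-- The condition on an entry `A` and the entry `B` below it. -/
def SouthOK (A B : SetEntry) : Prop :=
  A.maxLetter ≤ B.minLetter ∧ (¬ A.maxLetter.IsPrimed → A.maxLetter < B.minLetter)

theorem EastOK.trans_le {A B C : SetEntry} (h : EastOK A B) (h' : B.maxLetter ≤ C.minLetter) :
    EastOK A C :=
  have hBC := B.minLetter_le_maxLetter.trans h'
  ⟨h.1.trans hBC, fun hp => (h.2 hp).trans_le hBC⟩

theorem SouthOK.trans_le {A B C : SetEntry} (h : SouthOK A B) (h' : B.maxLetter ≤ C.minLetter) :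
    SouthOK A C :=
  have hBC := B.minLetter_le_maxLetter.trans h'
  ⟨h.1.trans hBC, fun hp => (h.2 hp).trans_le hBC⟩

theorem EastOK.key_lt {A B : SetEntry} (h : EastOK A B) {m m' : ℤ} (hm : m < m') :
    key A.minLetter m < key B.minLetter m' := by
  rw [key_lt_key_iff]
  rcases (A.minLetter_le_maxLetter.trans h.1).lt_or_eq with hlt | heq
  · exact Or.inl hlt
  · have hmax : A.maxLetter = A.minLetter :=
      le_antisymm (h.1.trans heq.ge) A.minLetter_le_maxLetter
    refine Or.inr ⟨heq, fun hp => ?_, fun _ => hm⟩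
    have := h.2 (hmax ▸ hp)
    rw [hmax, heq] at this
    exact absurd this (lt_irrefl _)

theorem SouthOK.key_lt {A B : SetEntry} (h : SouthOK A B) {m m' : ℤ} (hm : m' < m) :
    key A.minLetter m < key B.minLetter m' := by
  rw [key_lt_key_iff]
  rcases (A.minLetter_le_maxLetter.trans h.1).lt_or_eq with hlt | heq
  · exact Or.inl hlt
  · have hmax : A.maxLetter = A.minLetter :=
      le_antisymm (h.1.trans heq.ge) A.minLetter_le_maxLetter
    refine Or.inr ⟨heq, fun _ => hm, fun hp => ?_⟩
    have := h.2 (hmax ▸ hp)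
    rw [hmax, heq] at this
    exact absurd this (lt_irrefl _)

/-! ### Lengths of diagonals -/

/-- The number of boxes on the diagonal `D_j`, `j ≥ 0`. -/
def diagLen (μ : YoungDiagram) (j : ℕ) : ℕ :=
  ((Finset.range (μ.colLen 0)).filter fun p => (p, p + j) ∈ μ).card

theorem lt_card_filter_range_iff {R : ℕ} {q : ℕ → Prop} [DecidablePred q]
    (hR : ∀ p, q p → p < R) (hq : ∀ p p', p ≤ p' → q p' → q p) {p : ℕ} :
    p < ((Finset.range R).filter q).card ↔ q p := by
  constructor
  · intro h
    by_contra hp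
    have : (Finset.range R).filter q ⊆ Finset.range p := by
      intro x hx
      rw [Finset.mem_filter] at hx
      rw [Finset.mem_range]
      by_contra hx'
      exact hp (hq p x (not_lt.1 hx') hx.2)
    have := Finset.card_le_card this
    rw [Finset.card_range] at this
    omega
  · intro h
    have : Finset.range (p + 1) ⊆ (Finset.range R).filter q := by
      intro x hx
      rw [Finset.mem_range] at hx
      have := hq x p (by omega) h
      exact Finset.mem_filter.2 ⟨Finset.mem_range.2 (hR x this), this⟩
    have := Finset.card_le_card this
    rw [Finset.card_range] at this
    omega

theorem lt_card_filter_range_iff' {R : ℕ} {q : ℕ → Prop} [DecidablePred q]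
    (hq : ∀ p p', p ≤ p' → p' < R → q p' → q p) {p : ℕ} :
    p < ((Finset.range R).filter q).card ↔ p < R ∧ q p := by
  have heq : (Finset.range R).filter q = (Finset.range R).filter (fun i => i < R ∧ q i) :=
    Finset.filter_congr fun i hi => by simp [Finset.mem_range.1 hi]
  rw [heq]
  exact lt_card_filter_range_iff (q := fun i => i < R ∧ q i) (fun p hp => hp.1)
    fun p p' hp hp' => ⟨hp.trans_lt hp'.1, hq p p' hp hp'.1 hp'.2⟩

theorem lt_diagLen_iff {μ : YoungDiagram} {j p : ℕ} : p < diagLen μ j ↔ (p, p + j) ∈ μ := by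
  refine lt_card_filter_range_iff (q := fun p => (p, p + j) ∈ μ) ?_ ?_
  · intro p hp
    rw [← YoungDiagram.mem_iff_lt_colLen]
    exact μ.up_left_mem le_rfl (Nat.zero_le _) hp
  · intro p p' h hp
    exact μ.up_left_mem h (by omega) hp

theorem diagLen_succ_le (μ : YoungDiagram) (j : ℕ) : diagLen μ (j + 1) ≤ diagLen μ j := by
  by_contra h
  have h' := lt_diagLen_iff.1 (not_le.1 h)
  exact lt_irrefl _ (lt_diagLen_iff.2 (μ.up_left_mem le_rfl (by omega) h'))

theorem diagLen_le_succ (μ : YoungDiagram) (j : ℕ) : diagLen μ j ≤ diagLen μ (j + 1) + 1 := by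
  by_contra h
  have h' := lt_diagLen_iff.1 (not_le.1 h)
  have : (diagLen μ (j + 1), diagLen μ (j + 1) + (j + 1)) ∈ μ :=
    μ.up_left_mem (by omega) (by omega) h'
  exact lt_irrefl _ (lt_diagLen_iff.2 this)

/-! ### Shifted set-valued tableaux by their diagonals -/

theorem filterMap_range_eq_map {α : Type*} {f : ℕ → Option α} {g : ℕ → α} {l R : ℕ} (hl : l ≤ R)
    (h : ∀ i < l, f i = some (g i)) (h' : ∀ i, l ≤ i → f i = none) :
    (List.range R).filterMap f = (List.range l).map g := by
  obtain ⟨d, rfl⟩ := Nat.exists_eq_add_of_le hl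
  rw [List.range_add, List.filterMap_append]
  have h1 : (List.range l).filterMap f = (List.range l).map g := by
    rw [← List.filterMap_eq_map]
    exact List.filterMap_congr fun i hi => h i (List.mem_range.1 hi)
  have h2 : ((List.range d).map fun x => l + x).filterMap f = [] := by
    rw [List.filterMap_eq_nil_iff]
    intro a ha
    obtain ⟨x, -, rfl⟩ := List.mem_map.1 ha
    exact h' _ (by omega)
  rw [h1, h2, List.append_nil]

namespace ShiftedSetTableau

variable {μ : YoungDiagram} (t : ShiftedSetTableau μ)

/-- The `i`-th entry, counted from `0`, on the diagonal `D_k`; the value for `i ≥ diagLen μ k` is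
a default. -/
noncomputable def entry (k i : ℕ) : SetEntry :=
  (t.fill (i, i + k)).getD ⟨{toLex (1, false)}, Finset.singleton_nonempty _⟩

theorem fill_eq_some_entry {k i : ℕ} (h : i < diagLen μ k) :
    t.fill (i, i + k) = some (t.entry k i) := by
  have : (t.fill (i, i + k)).isSome :=
    (t.fill_isSome_iff _).2 ⟨lt_diagLen_iff.1 h, by simp [content]⟩
  obtain ⟨A, hA⟩ := Option.isSome_iff_exists.1 this
  simp [entry, hA]

theorem fill_eq_none {k i : ℕ} (h : ¬ i < diagLen μ k) : t.fill (i, i + k) = none := by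
  rw [lt_diagLen_iff] at h
  rw [← Option.not_isSome_iff_eq_none, t.fill_isSome_iff]
  exact fun h' => h h'.1

theorem eastOK {k i : ℕ} (h : i < diagLen μ (k + 1)) :
    EastOK (t.entry k i) (t.entry (k + 1) i) := by
  have hA := t.fill_eq_some_entry (h.trans_le (diagLen_succ_le μ k))
  have hB := t.fill_eq_some_entry h
  have hle := t.row_weak i (i + k) (i + (k + 1)) _ _ (by omega) hA hB
  refine ⟨hle, fun hp => hle.lt_of_ne fun heq => ?_⟩
  have := t.row_primed i (i + k) (i + (k + 1)) _ _ _ hA hB hp (Finset.max'_mem _ _)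
    (heq ▸ Finset.min'_mem _ _)
  omega

theorem southOK {k i : ℕ} (h : i + 1 < diagLen μ k) :
    SouthOK (t.entry (k + 1) i) (t.entry k (i + 1)) := by
  have hA := t.fill_eq_some_entry (k := k + 1) (i := i)
    (by have := diagLen_le_succ μ k; omega)
  have hB := t.fill_eq_some_entry h
  rw [show i + 1 + k = i + (k + 1) by omega] at hB
  have hle := t.col_weak i (i + 1) (i + (k + 1)) _ _ (by omega) hA hB
  refine ⟨hle, fun hp => hle.lt_of_ne fun heq => ?_⟩
  have := t.col_unprimed i (i + 1) (i + (k + 1)) _ _ _ hA hB hp (Finset.max'_mem _ _)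
    (heq ▸ Finset.min'_mem _ _)
  omega

theorem diagonalWord_eq (k : ℕ) :
    t.diagonalWord k = (List.range (diagLen μ k)).map (t.entry k) := by
  refine filterMap_range_eq_map ?_ (fun i hi => t.fill_eq_some_entry hi)
    fun i hi => t.fill_eq_none (not_lt.2 hi)
  exact (Finset.card_filter_le _ _).trans (Finset.card_range _).le

/-- A shifted set-valued tableau is determined by the entries on its diagonals. -/
theorem ext_entry {t t' : ShiftedSetTableau μ}
    (h : ∀ k i, i < diagLen μ k → t.entry k i = t'.entry k i) : t = t' := by
  ext1
  funext ⟨i, j⟩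
  rcases le_or_gt i j with hij | hij
  · obtain ⟨k, rfl⟩ := Nat.exists_eq_add_of_le hij
    by_cases hi : i < diagLen μ k
    · rw [t.fill_eq_some_entry hi, t'.fill_eq_some_entry hi, h k i hi]
    · rw [t.fill_eq_none hi, t'.fill_eq_none hi]
  · have : ∀ s : ShiftedSetTableau μ, s.fill (i, j) = none := fun s => by
      rw [← Option.not_isSome_iff_eq_none, s.fill_isSome_iff]
      rintro ⟨-, h2⟩
      simp only [content] at h2
      omega
    rw [this, this]

/-- Entries on the diagonals that satisfy the conditions for horizontal and vertical neighbours form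
a shifted set-valued tableau. -/
theorem exists_entry_eq (v : ℕ → ℕ → SetEntry)
    (heast : ∀ k i, i < diagLen μ (k + 1) → EastOK (v k i) (v (k + 1) i))
    (hsouth : ∀ k i, i + 1 < diagLen μ k → SouthOK (v (k + 1) i) (v k (i + 1))) :
    ∃ t : ShiftedSetTableau μ, ∀ k i, i < diagLen μ k → t.entry k i = v k i := by
  classical
  have hE : ∀ d i k, i < diagLen μ (k + d + 1) → EastOK (v k i) (v (k + d + 1) i) := by
    intro d
    induction d with
    | zero => exact fun i k h => heast k i h
    | succ d ih =>
      intro i k h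
      exact (ih i k (h.trans_le (diagLen_succ_le _ _))).trans_le (heast (k + d + 1) i h).1
  have hS : ∀ d i k, i + d + 1 < diagLen μ k → SouthOK (v (k + d + 1) i) (v k (i + d + 1)) := by
    intro d
    induction d with
    | zero => exact fun i k h => hsouth k i h
    | succ d ih =>
      intro i k h
      have h1 : i + d + 1 < diagLen μ (k + 1) := by have := diagLen_le_succ μ k; omega
      have h2 := ih i (k + 1) h1
      rw [show k + 1 + d + 1 = k + (d + 1) + 1 by omega] at h2
      exact h2.trans_le (hsouth k (i + d + 1) h).1
  let f : ℕ × ℕ → Option SetEntry := fun c =>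
    if c ∈ μ ∧ c.1 ≤ c.2 then some (v (c.2 - c.1) c.1) else none
  have hf : ∀ i j A, f (i, j) = some A → (i, j) ∈ μ ∧ i ≤ j ∧ A = v (j - i) i := by
    intro i j A h
    by_cases hc : (i, j) ∈ μ ∧ i ≤ j
    · simp only [f, hc, and_self, if_true, Option.some.injEq] at h
      exact ⟨hc.1, hc.2, h.symm⟩
    · simp [f, hc] at h
  have hrow : ∀ i j j' A B, j < j' → f (i, j) = some A → f (i, j') = some B → EastOK A B := by
    intro i j j' A B hj hA hB
    obtain ⟨-, h2, rfl⟩ := hf _ _ _ hA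
    obtain ⟨h1', h2', rfl⟩ := hf _ _ _ hB
    have := hE (j' - j - 1) i (j - i) (lt_diagLen_iff.2 (by
      rwa [show i + (j - i + (j' - j - 1) + 1) = j' by omega]))
    rwa [show j - i + (j' - j - 1) + 1 = j' - i by omega] at this
  have hcol : ∀ i i' j A B, i < i' → f (i, j) = some A → f (i', j) = some B → SouthOK A B := by
    intro i i' j A B hj hA hB
    obtain ⟨-, h2, rfl⟩ := hf _ _ _ hA
    obtain ⟨h1', h2', rfl⟩ := hf _ _ _ hB
    have := hS (i' - i - 1) i (j - i') (lt_diagLen_iff.2 (by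
      rwa [show i + (i' - i - 1) + 1 = i' by omega, show i' + (j - i') = j by omega]))
    rwa [show j - i' + (i' - i - 1) + 1 = j - i by omega,
      show i + (i' - i - 1) + 1 = i' by omega] at this
  refine ⟨⟨f, ?_, fun i j j' A B h hA hB => (hrow i j j' A B h hA hB).1,
    fun i i' j A B h hA hB => (hcol i i' j A B h hA hB).1, ?_, ?_⟩, ?_⟩
  · intro c
    have : (0 ≤ content c) ↔ c.1 ≤ c.2 := by simp [content]
    rw [this]
    by_cases hc : c ∈ μ ∧ c.1 ≤ c.2
    · simp [f, hc]
    · simp [f, hc]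
  · intro i i' j A B x hA hB hp hxA hxB
    by_contra hne
    wlog hlt : i < i' generalizing i i' A B
    · exact this i' i B A hB hA hxB hxA (Ne.symm hne) (by omega)
    have h := hcol i i' j A B hlt hA hB
    have hmax : A.maxLetter = x :=
      le_antisymm (h.1.trans (SetEntry.minLetter_le hxB)) (SetEntry.le_maxLetter hxA)
    exact absurd ((h.2 (hmax ▸ hp)).trans_le (SetEntry.minLetter_le hxB)) (by simp [hmax])
  · intro i j j' A B x hA hB hp hxA hxB
    by_contra hne
    wlog hlt : j < j' generalizing j j' A B
    · exact this j' j B A hB hA hxB hxA (Ne.symm hne) (by omega)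
    have h := hrow i j j' A B hlt hA hB
    have hmax : A.maxLetter = x :=
      le_antisymm (h.1.trans (SetEntry.minLetter_le hxB)) (SetEntry.le_maxLetter hxA)
    exact absurd ((h.2 (hmax ▸ hp)).trans_le (SetEntry.minLetter_le hxB)) (by simp [hmax])
  · intro k i hi
    have : (i, i + k) ∈ μ ∧ i ≤ i + k := ⟨lt_diagLen_iff.1 hi, by omega⟩
    simp [entry, f, this.1]

end ShiftedSetTableau

/-! ### Stations of dominoes -/

namespace Domino

/-- The box of a domino on the diagonal of larger index, which is the northeastern one. -/
def hi : Domino → ℕ × ℕ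
  | horiz i j => (i, j + 1)
  | vert i j => (i, j)

/-- The box of a domino on the diagonal of smaller index, which is the southwestern one. -/
def lo : Domino → ℕ × ℕ
  | horiz i j => (i, j)
  | vert i j => (i + 1, j)

/-- The station of a domino is the index `s` of the diagonal through its northeastern box; the
other box lies on `D_{s-1}`. It encodes type and diagonal at the same time: dominoes of type 1 on
`D_{2k}` have station `2k` and those of type 2 have station `2k + 1`. -/
def station (d : Domino) : ℤ := content d.hi

theorem mem_cells {d : Domino} {c : ℕ × ℕ} : c ∈ d.cells ↔ c = d.hi ∨ c = d.lo := by
  cases d <;> simp [cells, hi, lo, topLeft, bottomRight, or_comm]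

theorem hi_mem (d : Domino) : d.hi ∈ d.cells := mem_cells.2 (Or.inl rfl)

theorem lo_mem (d : Domino) : d.lo ∈ d.cells := mem_cells.2 (Or.inr rfl)

theorem content_hi (d : Domino) : content d.hi = d.station := rfl

theorem content_lo (d : Domino) : content d.lo = d.station - 1 := by
  cases d <;> simp [station, content, hi, lo] <;> omega

theorem hi_lo_cases (d : Domino) :
    d.lo.1 = d.hi.1 ∧ d.lo.2 + 1 = d.hi.2 ∨ d.lo.1 = d.hi.1 + 1 ∧ d.lo.2 = d.hi.2 := by
  cases d <;> simp [hi, lo]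

theorem ext_hi_lo {d e : Domino} (h : d.hi = e.hi) (h' : d.lo = e.lo) : d = e := by
  cases d <;> cases e <;> simp [hi, lo] at h h' ⊢ <;> omega

theorem evenCell_eq (d : Domino) : d.evenCell = if d.station % 2 = 0 then d.hi else d.lo := by
  cases d with
  | horiz i j =>
    have h1 : content (horiz i j).topLeft = (j : ℤ) - i := rfl
    have h2 : (horiz i j).station = (j : ℤ) + 1 - i := by simp [station, content, hi]
    rw [evenCell, h1, h2]
    by_cases h : ((j : ℤ) - i) % 2 = 0
    · rw [if_pos h, if_neg (by omega)]; rfl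
    · rw [if_neg h, if_pos (by omega)]; rfl
  | vert i j =>
    rfl

theorem diagonal_eq (d : Domino) : d.diagonal = d.station / 2 := by
  rw [diagonal, evenCell_eq]
  split_ifs with h
  · rfl
  · rw [content_lo]; omega

theorem diagonal_nonneg_iff {d : Domino} : 0 ≤ d.diagonal ↔ 0 ≤ d.station := by
  rw [diagonal_eq]; omega

theorem diagonal_neg_iff {d : Domino} : d.diagonal < 0 ↔ d.station < 0 := by
  rw [diagonal_eq]; omega

theorem type_eq (d : Domino) :
    d.type = if d.station % 2 = 0 then DominoType.one else DominoType.two := by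
  cases d with
  | horiz i j =>
    simp only [type, evenCell, oddCell, station, content, hi, topLeft, bottomRight]
    by_cases h : ((j : ℤ) - i) % 2 = 0
    · simp [h]; omega
    · simp [h]; omega
  | vert i j =>
    simp only [type, evenCell, oddCell, station, content, hi, topLeft, bottomRight]
    by_cases h : ((j : ℤ) - i) % 2 = 0
    · simp [h]
    · simp [h]

theorem type_eq_one_iff {d : Domino} : d.type = DominoType.one ↔ d.station % 2 = 0 := by
  rw [type_eq]; split_ifs with h <;> simp [h]

theorem type_eq_two_iff {d : Domino} : d.type = DominoType.two ↔ d.station % 2 = 1 := by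
  rw [type_eq]; split_ifs with h <;> simp [h]; omega

theorem eq_hi_of_mem {d : Domino} {c : ℕ × ℕ} (h : c ∈ d.cells) (hc : content c = d.station) :
    c = d.hi := by
  rcases mem_cells.1 h with h | rfl
  · exact h
  · rw [content_lo] at hc; omega

theorem eq_lo_of_mem {d : Domino} {c : ℕ × ℕ} (h : c ∈ d.cells)
    (hc : content c = d.station - 1) : c = d.lo := by
  rcases mem_cells.1 h with rfl | h
  · rw [content_hi] at hc; omega
  · exact h

theorem content_of_mem {d : Domino} {c : ℕ × ℕ} (h : c ∈ d.cells) :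
    content c = d.station ∨ content c = d.station - 1 := by
  rcases mem_cells.1 h with rfl | rfl
  · exact Or.inl d.content_hi
  · exact Or.inr d.content_lo

theorem topLeft_mem (d : Domino) : d.topLeft ∈ d.cells := Finset.mem_insert_self _ _

theorem topLeft_le_of_mem {d : Domino} {c : ℕ × ℕ} (h : c ∈ d.cells) :
    d.topLeft.1 ≤ c.1 ∧ d.topLeft.2 ≤ c.2 := by
  rcases mem_cells.1 h with rfl | rfl <;> cases d <;> simp [topLeft, hi, lo]

theorem eq_of_content_eq {d : Domino} {c c' : ℕ × ℕ} (h : c ∈ d.cells) (h' : c' ∈ d.cells)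
    (hc : content c = content c') : c = c' := by
  rcases Domino.content_of_mem h with h1 | h1
  · rw [Domino.eq_hi_of_mem h h1, Domino.eq_hi_of_mem h' (hc ▸ h1)]
  · rw [Domino.eq_lo_of_mem h h1, Domino.eq_lo_of_mem h' (hc ▸ h1)]

theorem isVertical_iff {d : Domino} : d.IsVertical ↔ d.lo.1 = d.hi.1 + 1 := by
  cases d <;> simp [Domino.IsVertical, Domino.lo, Domino.hi]

end Domino

/-! ### Counting dominoes of a paving -/

open Classical in
/-- The number of dominoes with station `s` in a set of dominoes. -/
noncomputable def stationCount (P : Finset Domino) (s : ℤ) : ℕ :=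
  (P.filter fun d => d.station = s).card

theorem IsPaving.hi_mem {lam : YoungDiagram} {P : Finset Domino} (hP : IsPaving lam P)
    {d : Domino} (hd : d ∈ P) : d.hi ∈ lam := hP.1 d hd d.hi_mem

theorem IsPaving.lo_mem {lam : YoungDiagram} {P : Finset Domino} (hP : IsPaving lam P)
    {d : Domino} (hd : d ∈ P) : d.lo ∈ lam := hP.1 d hd d.lo_mem

theorem IsPaving.eq_of_mem {lam : YoungDiagram} {P : Finset Domino} (hP : IsPaving lam P)
    {d e : Domino} (hd : d ∈ P) (he : e ∈ P) {c : ℕ × ℕ} (hcd : c ∈ d.cells) (hce : c ∈ e.cells) :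
    d = e :=
  (hP.2 c (hP.1 d hd hcd)).unique ⟨hd, hcd⟩ ⟨he, hce⟩

theorem IsPaving.card_content_eq {lam : YoungDiagram} {P : Finset Domino} (hP : IsPaving lam P)
    (s : ℤ) :
    (lam.cells.filter fun c => content c = s).card =
      stationCount P s + stationCount P (s + 1) := by
  classical
  have hdisj : Disjoint (P.filter fun d => d.station = s)
      (P.filter fun d => d.station = s + 1) := by
    rw [Finset.disjoint_filter]
    intro d _ h h'
    omega
  rw [stationCount, stationCount, ← Finset.card_union_of_disjoint hdisj, ← Finset.filter_or]
  symm
  refine Finset.card_bij (fun d _ => if d.station = s then d.hi else d.lo) ?_ ?_ ?_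
  · intro d hd
    rw [Finset.mem_filter] at hd
    rw [Finset.mem_filter]
    split_ifs with h
    · exact ⟨hP.hi_mem hd.1, h⟩
    · refine ⟨hP.lo_mem hd.1, ?_⟩
      rw [d.content_lo]
      rcases hd.2 with h' | h' <;> omega
  · intro d hd e he h
    rw [Finset.mem_filter] at hd he
    have hd' : (if d.station = s then d.hi else d.lo) ∈ d.cells := by
      split_ifs
      exacts [d.hi_mem, d.lo_mem]
    have he' : (if e.station = s then e.hi else e.lo) ∈ e.cells := by
      split_ifs
      exacts [e.hi_mem, e.lo_mem]
    exact hP.eq_of_mem hd.1 he.1 hd' (h ▸ he')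
  · intro c hc
    rw [Finset.mem_filter] at hc
    obtain ⟨d, ⟨hd, hcd⟩, -⟩ := hP.2 c hc.1
    rcases Domino.content_of_mem hcd with h | h
    · have hs : d.station = s := by rw [← h, hc.2]
      refine ⟨d, Finset.mem_filter.2 ⟨hd, Or.inl hs⟩, ?_⟩
      rw [if_pos hs, Domino.eq_hi_of_mem hcd h]
    · have hs : d.station = s + 1 := by rw [hc.2] at h; omega
      refine ⟨d, Finset.mem_filter.2 ⟨hd, Or.inr hs⟩, ?_⟩
      rw [if_neg (by omega), Domino.eq_lo_of_mem hcd h]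

theorem card_content_eq_diagLen (lam : YoungDiagram) (j : ℕ) :
    (lam.cells.filter fun c => content c = j).card = diagLen lam j := by
  classical
  rw [diagLen]
  symm
  refine Finset.card_bij (fun p _ => (p, p + j)) ?_ ?_ ?_
  · intro p hp
    rw [Finset.mem_filter] at hp ⊢
    exact ⟨hp.2, by simp [content]⟩
  · intro p _ p' _ h
    exact (Prod.ext_iff.1 h).1
  · rintro ⟨p, q⟩ hc
    rw [Finset.mem_filter] at hc
    obtain ⟨hc, hs⟩ := hc
    simp only [content] at hs
    obtain rfl : q = p + j := by omega
    refine ⟨p, Finset.mem_filter.2 ⟨?_, hc⟩, rfl⟩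
    rw [Finset.mem_range, ← YoungDiagram.mem_iff_lt_colLen]
    exact lam.up_left_mem le_rfl (Nat.zero_le _) hc

theorem card_content_neg_eq_diagLen (lam : YoungDiagram) (j : ℕ) :
    (lam.cells.filter fun c => content c = -j).card = diagLen lam.transpose j := by
  classical
  rw [← card_content_eq_diagLen]
  refine Finset.card_bij (fun c _ => c.swap) ?_ ?_ ?_
  · rintro ⟨p, q⟩ hc
    rw [Finset.mem_filter] at hc ⊢
    refine ⟨YoungDiagram.mem_transpose.2 hc.1, ?_⟩
    have := hc.2
    simp only [content, Prod.swap] at this ⊢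
    omega
  · intro c _ c' _ h
    exact Prod.swap_injective h
  · rintro ⟨p, q⟩ hc
    rw [Finset.mem_filter] at hc
    refine ⟨(q, p), Finset.mem_filter.2 ⟨YoungDiagram.mem_transpose.1 hc.1, ?_⟩, rfl⟩
    have := hc.2
    simp only [content] at this ⊢
    omega

theorem IsPaving.diagLen_eq {lam : YoungDiagram} {P : Finset Domino} (hP : IsPaving lam P)
    (j : ℕ) : diagLen lam j = stationCount P j + stationCount P (j + 1) := by
  rw [← card_content_eq_diagLen, hP.card_content_eq]

theorem IsPaving.diagLen_transpose_eq {lam : YoungDiagram} {P : Finset Domino}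
    (hP : IsPaving lam P) (j : ℕ) :
    diagLen lam.transpose j = stationCount P (1 - j) + stationCount P (1 - (j + 1)) := by
  rw [← card_content_neg_eq_diagLen, hP.card_content_eq]
  rw [add_comm]
  congr 2 <;> ring

theorem lt_diagLen_transpose_iff {lam : YoungDiagram} {j p : ℕ} :
    p < diagLen lam.transpose j ↔ (p + j, p) ∈ lam := by
  rw [lt_diagLen_iff, YoungDiagram.mem_transpose, Prod.swap]

/-! ### Diagonal systems and the ranks of their nodes -/

/-- A diagonal system records, for every station `m`, the number `n m` of dominoes with this station
and their entries `w m i`, `i < n m`, from northwest to southeast. Equivalently, the entries of even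
station are the diagonals of one shifted set-valued tableau, and those of odd station are the
diagonals of another one; the conditions compare neighbouring diagonals of each of the two. -/
structure IsDiagonalSystem (n : ℕ → ℕ) (w : ℕ → ℕ → SetEntry) : Prop where
  len_le : ∀ m, n (m + 2) ≤ n m
  le_len : ∀ m, n m ≤ n (m + 2) + 1
  east : ∀ m i, i < n (m + 2) → EastOK (w m i) (w (m + 2) i)
  south : ∀ m i, i + 1 < n m → SouthOK (w (m + 2) i) (w m (i + 1))

/-- The key of the `i`-th node of station `m`. -/
noncomputable def nodeKey (w : ℕ → ℕ → SetEntry) (m i : ℕ) : Letter ×ₗ ℤ :=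
  key (w m i).minLetter m

/-- The number of nodes of station `m` whose key is smaller than `κ`. -/
noncomputable def countLT (n : ℕ → ℕ) (w : ℕ → ℕ → SetEntry) (m : ℕ) (κ : Letter ×ₗ ℤ) : ℕ :=
  ((Finset.range (n m)).filter fun i => nodeKey w m i < κ).card

/-- The number of nodes on a diagonal with key smaller than `κ`, where `rank (j + 1)` belongs to the
diagonal `D_j`. The value `rank 0` is the row in which a domino of station `0` and key `κ` meets
`D_{-1}`: on `D_{-1}` the dominoes of station `1` are missing, and the maximum with `1` makes
a domino of station `0` vertical exactly if no domino of station `1` precedes it. -/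
noncomputable def rank (n : ℕ → ℕ) (w : ℕ → ℕ → SetEntry) : ℕ → Letter ×ₗ ℤ → ℕ
  | 0, κ => countLT n w 0 κ + max 1 (countLT n w 1 κ)
  | m + 1, κ => countLT n w m κ + countLT n w (m + 1) κ

/-- The domino of the `i`-th node of station `m`. Its boxes are in the rows given by the ranks of
its key on the diagonals `D_m` and `D_{m-1}`. -/
noncomputable def nodeDomino (n : ℕ → ℕ) (w : ℕ → ℕ → SetEntry) (m i : ℕ) : Domino :=
  let p := rank n w (m + 1) (nodeKey w m i)
  if rank n w m (nodeKey w m i) = p then Domino.horiz p (p + m - 1) else Domino.vert p (p + m)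

theorem nodeKey_station {w w' : ℕ → ℕ → SetEntry} {m m' i i' : ℕ}
    (h : nodeKey w m i = nodeKey w' m' i') : m = m' := by
  exact_mod_cast (key_inj.1 h).2

theorem countLT_mono {n : ℕ → ℕ} {w : ℕ → ℕ → SetEntry} (m : ℕ) {κ κ' : Letter ×ₗ ℤ}
    (h : κ ≤ κ') : countLT n w m κ ≤ countLT n w m κ' :=
  Finset.card_le_card (Finset.monotone_filter_right _ fun _ _ h' => lt_of_lt_of_le h' h)

theorem countLT_le {n : ℕ → ℕ} {w : ℕ → ℕ → SetEntry} (m : ℕ) (κ : Letter ×ₗ ℤ) :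
    countLT n w m κ ≤ n m :=
  (Finset.card_filter_le _ _).trans (Finset.card_range _).le

theorem one_le_rank_add {n : ℕ → ℕ} {w : ℕ → ℕ → SetEntry} (m : ℕ) (κ : Letter ×ₗ ℤ) :
    1 ≤ rank n w m κ + m := by
  cases m with
  | zero => simp only [rank]; omega
  | succ m => omega

theorem hi_nodeDomino {n : ℕ → ℕ} {w : ℕ → ℕ → SetEntry} (m i : ℕ) :
    (nodeDomino n w m i).hi =
      (rank n w (m + 1) (nodeKey w m i), rank n w (m + 1) (nodeKey w m i) + m) := by
  have h1 := one_le_rank_add (n := n) (w := w) m (nodeKey w m i)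
  simp only [nodeDomino]
  split_ifs with hq
  · rw [hq] at h1
    simp only [Domino.hi, Prod.mk.injEq, true_and]
    omega
  · rfl

theorem station_nodeDomino {n : ℕ → ℕ} {w : ℕ → ℕ → SetEntry} (m i : ℕ) :
    (nodeDomino n w m i).station = m := by
  rw [← Domino.content_hi, hi_nodeDomino, content]
  push_cast
  ring

namespace IsDiagonalSystem

variable {n : ℕ → ℕ} {w : ℕ → ℕ → SetEntry}

theorem nodeKey_east (h : IsDiagonalSystem n w) {m i : ℕ} (hi : i < n (m + 2)) :
    nodeKey w m i < nodeKey w (m + 2) i :=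
  (h.east m i hi).key_lt (by push_cast; omega)

theorem nodeKey_south (h : IsDiagonalSystem n w) {m i : ℕ} (hi : i + 1 < n m) :
    nodeKey w (m + 2) i < nodeKey w m (i + 1) :=
  (h.south m i hi).key_lt (by push_cast; omega)

theorem nodeKey_lt_succ (h : IsDiagonalSystem n w) {m i : ℕ} (hi : i + 1 < n m) :
    nodeKey w m i < nodeKey w m (i + 1) :=
  (h.nodeKey_east (by have := h.le_len m; omega)).trans (h.nodeKey_south hi)

theorem nodeKey_lt (h : IsDiagonalSystem n w) {m i i' : ℕ} (hi : i < i') (hi' : i' < n m) :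
    nodeKey w m i < nodeKey w m i' := by
  induction i', hi using Nat.le_induction with
  | base => exact h.nodeKey_lt_succ hi'
  | succ i' _ ih => exact (ih (by omega)).trans (h.nodeKey_lt_succ hi')

theorem nodeKey_inj (h : IsDiagonalSystem n w) {m m' i i' : ℕ} (hi : i < n m) (hi' : i' < n m')
    (hk : nodeKey w m i = nodeKey w m' i') : m = m' ∧ i = i' := by
  obtain rfl := nodeKey_station hk
  refine ⟨rfl, ?_⟩
  by_contra hne
  rcases Nat.lt_or_gt_of_ne hne with hlt | hlt
  · exact (h.nodeKey_lt hlt hi').ne hk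
  · exact (h.nodeKey_lt hlt hi).ne' hk

theorem lt_countLT_iff (h : IsDiagonalSystem n w) {m i : ℕ} {κ : Letter ×ₗ ℤ} :
    i < countLT n w m κ ↔ i < n m ∧ nodeKey w m i < κ := by
  refine lt_card_filter_range_iff' fun p p' hp hp' hk => ?_
  rcases hp.lt_or_eq with hlt | rfl
  · exact (h.nodeKey_lt hlt hp').trans hk
  · exact hk

theorem countLT_nodeKey (h : IsDiagonalSystem n w) {m i : ℕ} (hi : i < n m) :
    countLT n w m (nodeKey w m i) = i := by
  refine le_antisymm ?_ ?_
  · by_contra hn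
    exact lt_irrefl _ (h.lt_countLT_iff.1 (not_le.1 hn)).2
  · by_contra hn
    have hlt := not_le.1 hn
    exact lt_irrefl _ (h.lt_countLT_iff.2 ⟨hlt.trans hi, h.nodeKey_lt hlt hi⟩)

theorem countLT_add_two_le (h : IsDiagonalSystem n w) (m : ℕ) (κ : Letter ×ₗ ℤ) :
    countLT n w (m + 2) κ ≤ countLT n w m κ := by
  by_contra hn
  obtain ⟨h1, h2⟩ := h.lt_countLT_iff.1 (not_le.1 hn)
  exact lt_irrefl _ (h.lt_countLT_iff.2 ⟨h1.trans_le (h.len_le m), (h.nodeKey_east h1).trans h2⟩)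

theorem countLT_le_add_two (h : IsDiagonalSystem n w) (m : ℕ) (κ : Letter ×ₗ ℤ) :
    countLT n w m κ ≤ countLT n w (m + 2) κ + 1 := by
  by_contra hn
  obtain ⟨h1, h2⟩ := h.lt_countLT_iff.1 (not_le.1 hn)
  refine lt_irrefl (countLT n w (m + 2) κ)
    (h.lt_countLT_iff.2 ⟨?_, (h.nodeKey_south h1).trans h2⟩)
  have := h.le_len m
  omega

theorem rank_succ_le (h : IsDiagonalSystem n w) (m : ℕ) (κ : Letter ×ₗ ℤ) :
    rank n w (m + 1) κ ≤ rank n w m κ := by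
  cases m with
  | zero => simp only [rank, zero_add]; omega
  | succ m =>
    have := h.countLT_add_two_le m κ
    change countLT n w (m + 1) κ + countLT n w (m + 2) κ ≤ countLT n w m κ + countLT n w (m + 1) κ
    omega

theorem rank_le_succ (h : IsDiagonalSystem n w) (m : ℕ) (κ : Letter ×ₗ ℤ) :
    rank n w m κ ≤ rank n w (m + 1) κ + 1 := by
  cases m with
  | zero => simp only [rank, zero_add]; omega
  | succ m =>
    have := h.countLT_le_add_two m κ
    change countLT n w m κ + countLT n w (m + 1) κ ≤
      countLT n w (m + 1) κ + countLT n w (m + 2) κ + 1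
    omega

theorem countLT_lt (h : IsDiagonalSystem n w) {m i : ℕ} (hi : i < n m) {κ : Letter ×ₗ ℤ}
    (hκ : nodeKey w m i < κ) : countLT n w m (nodeKey w m i) < countLT n w m κ := by
  rw [h.countLT_nodeKey hi]
  exact h.lt_countLT_iff.2 ⟨hi, hκ⟩

theorem rank_lt (h : IsDiagonalSystem n w) {m i : ℕ} (hi : i < n m) {κ : Letter ×ₗ ℤ}
    (hκ : nodeKey w m i < κ) : rank n w m (nodeKey w m i) < rank n w m κ := by
  have h1 := h.countLT_lt hi hκ
  cases m with
  | zero => have := countLT_mono (n := n) (w := w) 1 hκ.le; simp only [rank]; omega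
  | succ m => have := countLT_mono (n := n) (w := w) m hκ.le; simp only [rank]; omega

theorem rank_succ_lt (h : IsDiagonalSystem n w) {m i : ℕ} (hi : i < n m) {κ : Letter ×ₗ ℤ}
    (hκ : nodeKey w m i < κ) : rank n w (m + 1) (nodeKey w m i) < rank n w (m + 1) κ := by
  have h1 := h.countLT_lt hi hκ
  have := countLT_mono (n := n) (w := w) (m + 1) hκ.le
  simp only [rank]
  omega

/-- On `D_j` the rank grows strictly from a node of station `j` or `j + 1` to any larger key. -/
theorem rank_lt_of_station (h : IsDiagonalSystem n w) {j m i : ℕ} (hm : m = j ∨ m = j + 1)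
    (hi : i < n m) {κ : Letter ×ₗ ℤ} (hκ : nodeKey w m i < κ) :
    rank n w (j + 1) (nodeKey w m i) < rank n w (j + 1) κ := by
  rcases hm with rfl | rfl
  · exact h.rank_succ_lt hi hκ
  · exact h.rank_lt hi hκ

theorem rank_inj (h : IsDiagonalSystem n w) {j m i m' i' : ℕ} (hm : m = j ∨ m = j + 1)
    (hi : i < n m) (hm' : m' = j ∨ m' = j + 1) (hi' : i' < n m')
    (hr : rank n w (j + 1) (nodeKey w m i) = rank n w (j + 1) (nodeKey w m' i')) :
    m = m' ∧ i = i' := by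
  refine h.nodeKey_inj hi hi' ?_
  by_contra hne
  rcases lt_or_gt_of_ne hne with hlt | hlt
  · exact (h.rank_lt_of_station hm hi hlt).ne hr
  · exact (h.rank_lt_of_station hm' hi' hlt).ne' hr

theorem rank_lt_len (h : IsDiagonalSystem n w) {j m i : ℕ} (hm : m = j ∨ m = j + 1)
    (hi : i < n m) : rank n w (j + 1) (nodeKey w m i) < n j + n (j + 1) := by
  have h1 := h.countLT_nodeKey hi
  simp only [rank]
  rcases hm with rfl | rfl
  · have := countLT_le (n := n) (w := w) (m + 1) (nodeKey w m i); omega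
  · have := countLT_le (n := n) (w := w) j (nodeKey w (j + 1) i); omega

/-- The ranks of the nodes on `D_j` fill an initial segment of the natural numbers. -/
theorem exists_rank_eq (h : IsDiagonalSystem n w) {j p : ℕ} (hp : p < n j + n (j + 1)) :
    ∃ m i, (m = j ∨ m = j + 1) ∧ i < n m ∧ rank n w (j + 1) (nodeKey w m i) = p := by
  classical
  let N : Finset (Σ _ : ℕ, ℕ) := ({j, j + 1} : Finset ℕ).sigma fun m => Finset.range (n m)
  have hN : ∀ ν : (Σ _ : ℕ, ℕ), ν ∈ N ↔ (ν.1 = j ∨ ν.1 = j + 1) ∧ ν.2 < n ν.1 := fun ν => by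
    simp [N]
  have hcard : N.card = n j + n (j + 1) := by
    rw [Finset.card_sigma, Finset.sum_pair (by omega)]
    simp
  have hsurj := Finset.surjOn_of_injOn_of_card_le (s := N) (t := Finset.range (n j + n (j + 1)))
    (fun ν => rank n w (j + 1) (nodeKey w ν.1 ν.2))
    (fun ν hν => by
      have hν := (hN ν).1 hν
      exact Finset.mem_coe.2 (Finset.mem_range.2 (h.rank_lt_len hν.1 hν.2)))
    (fun ν hν ν' hν' he => by
      have hν := (hN ν).1 hν
      have hν' := (hN ν').1 hν'
      obtain ⟨h1, h2⟩ := h.rank_inj hν.1 hν.2 hν'.1 hν'.2 he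
      cases ν; cases ν'; simp only at h1 h2; subst h1; subst h2; rfl)
    (by rw [hcard, Finset.card_range])
  obtain ⟨ν, hν, he⟩ := hsurj (Finset.mem_coe.2 (Finset.mem_range.2 hp))
  have hν := (hN ν).1 hν
  exact ⟨ν.1, ν.2, hν.1, hν.2, he⟩

/-! ### The dominoes of the nodes -/

theorem lo_nodeDomino (h : IsDiagonalSystem n w) (m i : ℕ) :
    (nodeDomino n w m i).lo =
      (rank n w m (nodeKey w m i), rank n w m (nodeKey w m i) + m - 1) := by
  have h1 := h.rank_succ_le m (nodeKey w m i)
  have h2 := h.rank_le_succ m (nodeKey w m i)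
  simp only [nodeDomino]
  split_ifs with hq
  · rw [hq]; rfl
  · simp only [Domino.lo, Prod.mk.injEq]
    omega

theorem nodeDomino_inj (h : IsDiagonalSystem n w) {m i m' i' : ℕ} (hi : i < n m) (hi' : i' < n m')
    (he : nodeDomino n w m i = nodeDomino n w m' i') : m = m' ∧ i = i' := by
  have hm : m = m' := by
    have := station_nodeDomino (n := n) (w := w) m i
    rw [he, station_nodeDomino] at this
    exact_mod_cast this.symm
  subst hm
  have h1 := congrArg (fun d => d.hi.1) he
  simp only [hi_nodeDomino] at h1
  exact h.rank_inj (Or.inl rfl) hi (Or.inl rfl) hi' h1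

theorem evenCell_nodeDomino_lt (h : IsDiagonalSystem n w) {m i i' : ℕ} (hi : i < i')
    (hi' : i' < n m) : (nodeDomino n w m i).evenCell.1 < (nodeDomino n w m i').evenCell.1 := by
  have hk := h.nodeKey_lt hi hi'
  rw [Domino.evenCell_eq, Domino.evenCell_eq, station_nodeDomino, station_nodeDomino]
  split_ifs
  · rw [hi_nodeDomino, hi_nodeDomino]
    exact h.rank_succ_lt (hi.trans hi') hk
  · rw [h.lo_nodeDomino, h.lo_nodeDomino]
    exact h.rank_lt (hi.trans hi') hk

end IsDiagonalSystem

/-- The filled dominoes of a diagonal system. -/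
def systemUp (n : ℕ → ℕ) (w : ℕ → ℕ → SetEntry) : Set (Domino × SetEntry) :=
  {p | ∃ m i, i < n m ∧ p = (nodeDomino n w m i, w m i)}

namespace ShiftedSetDominoTableau

variable {lam : YoungDiagram} (T : ShiftedSetDominoTableau lam)

/-! ### Keys of the dominoes of a tableau -/

theorem isPaving : IsPaving lam T.paving := T.isShiftedPaving.paving

/-- The entry of a domino, with a default value if it carries none. -/
noncomputable def entry (d : Domino) : SetEntry :=
  (T.fill d).getD ⟨{toLex (1, false)}, Finset.singleton_nonempty _⟩

theorem isSome_fill_iff {d : Domino} : (T.fill d).isSome ↔ d ∈ T.paving ∧ 0 ≤ d.station := by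
  have := T.min_tableau.isSome_iff d
  rw [Option.isSome_map, Domino.diagonal_nonneg_iff] at this
  exact this

theorem fill_eq_some_entry {d : Domino} (hd : d ∈ T.paving) (hs : 0 ≤ d.station) :
    T.fill d = some (T.entry d) := by
  obtain ⟨A, hA⟩ := Option.isSome_iff_exists.1 (T.isSome_fill_iff.2 ⟨hd, hs⟩)
  simp [entry, hA]

theorem map_fill_eq {d : Domino} (hd : d ∈ T.paving) (hs : 0 ≤ d.station) :
    (T.fill d).map SetEntry.minLetter = some (T.entry d).minLetter := by
  rw [T.fill_eq_some_entry hd hs, Option.map_some]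

/-- The key of a domino: its smallest letter and its station. -/
noncomputable def dominoKey (d : Domino) : Letter ×ₗ ℤ := key (T.entry d).minLetter d.station

theorem letter_le_of_row {d e : Domino} (hd : d ∈ T.paving) (hds : 0 ≤ d.station)
    (he : e ∈ T.paving) (hes : 0 ≤ e.station) {i j j' : ℕ} (hj : j < j') (hdc : (i, j) ∈ d.cells)
    (hec : (i, j') ∈ e.cells) : (T.entry d).minLetter ≤ (T.entry e).minLetter :=
  T.min_tableau.row_weak d e _ _ (T.map_fill_eq hd hds) (T.map_fill_eq he hes)
    ⟨_, hdc, _, hec, rfl, hj⟩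

theorem letter_le_of_col {d e : Domino} (hd : d ∈ T.paving) (hds : 0 ≤ d.station)
    (he : e ∈ T.paving) (hes : 0 ≤ e.station) {i i' j : ℕ} (hj : i < i') (hdc : (i, j) ∈ d.cells)
    (hec : (i', j) ∈ e.cells) : (T.entry d).minLetter ≤ (T.entry e).minLetter :=
  T.min_tableau.col_weak d e _ _ (T.map_fill_eq hd hds) (T.map_fill_eq he hes)
    ⟨_, hdc, _, hec, rfl, hj⟩

theorem eq_of_primed_of_row {d e : Domino} (hd : d ∈ T.paving) (hds : 0 ≤ d.station)
    (he : e ∈ T.paving) (hes : 0 ≤ e.station) {i j j' : ℕ} (hdc : (i, j) ∈ d.cells)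
    (hec : (i, j') ∈ e.cells) (hx : (T.entry d).minLetter = (T.entry e).minLetter)
    (hp : (T.entry d).minLetter.IsPrimed) : d = e :=
  T.min_tableau.row_primed d e _ (T.map_fill_eq hd hds) (hx ▸ T.map_fill_eq he hes) hp
    ⟨_, hdc, _, hec, rfl⟩

theorem eq_of_unprimed_of_col {d e : Domino} (hd : d ∈ T.paving) (hds : 0 ≤ d.station)
    (he : e ∈ T.paving) (hes : 0 ≤ e.station) {i i' j : ℕ} (hdc : (i, j) ∈ d.cells)
    (hec : (i', j) ∈ e.cells) (hx : (T.entry d).minLetter = (T.entry e).minLetter)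
    (hp : ¬ (T.entry d).minLetter.IsPrimed) : d = e :=
  T.min_tableau.col_unprimed d e _ (T.map_fill_eq hd hds) (hx ▸ T.map_fill_eq he hes) hp
    ⟨_, hdc, _, hec, rfl⟩

theorem exists_domino {c : ℕ × ℕ} (hc : c ∈ lam) : ∃ d ∈ T.paving, c ∈ d.cells :=
  let ⟨d, hd, _⟩ := T.isPaving.2 c hc
  ⟨d, hd⟩

theorem station_nonneg_of_mem {d : Domino} {c : ℕ × ℕ} (hc : c ∈ d.cells) (h : 0 ≤ content c) :
    0 ≤ d.station := by
  rcases Domino.content_of_mem hc with h' | h' <;> omega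

/-- Keys strictly increase from a domino to a different domino on its right. If the letters agree
and are unprimed, the stations could only fail to increase if both dominoes were vertical and
staggered, and then the domino above the second one would repeat the letter in its column. -/
theorem eq_or_dominoKey_lt_right {d e : Domino} (hd : d ∈ T.paving) (he : e ∈ T.paving)
    {i j : ℕ} (hij : i ≤ j) (hdc : (i, j) ∈ d.cells) (hec : (i, j + 1) ∈ e.cells) :
    d = e ∨ T.dominoKey d < T.dominoKey e := by
  by_contra! hcon
  obtain ⟨hne, hcon⟩ := hcon
  refine absurd ?_ hcon.not_gt
  have hcd : content (i, j) = (j : ℤ) - i := rfl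
  have hce : content (i, j + 1) = (j : ℤ) + 1 - i := by simp [content]
  have hds : 0 ≤ d.station := station_nonneg_of_mem hdc (by omega)
  have hes : 0 ≤ e.station := station_nonneg_of_mem hec (by omega)
  have hle := T.letter_le_of_row hd hds he hes (Nat.lt_succ_self j) hdc hec
  rw [dominoKey, dominoKey, key_lt_key_iff]
  rcases hle.lt_or_eq with hlt | heq
  · exact Or.inl hlt
  refine Or.inr ⟨heq, fun hp => absurd (T.eq_of_primed_of_row hd hds he hes hdc hec heq hp) hne,
    fun hp => ?_⟩
  by_contra hst
  have hd1 := Domino.content_of_mem hdc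
  have he1 := Domino.content_of_mem hec
  have hdlo : (i, j) = d.lo := Domino.eq_lo_of_mem hdc (by omega)
  have hehi : (i, j + 1) = e.hi := Domino.eq_hi_of_mem hec (by omega)
  rcases d.hi_lo_cases with ⟨h1, h2⟩ | ⟨h1, h2⟩
  · rw [← hdlo] at h1 h2
    exact hne (T.isPaving.eq_of_mem hd he
      (by rw [show (i, j + 1) = d.hi from Prod.ext h1 h2]; exact d.hi_mem) hec)
  rw [← hdlo] at h1 h2
  simp only at h1 h2
  obtain ⟨a, rfl⟩ : ∃ a, i = a + 1 := ⟨_, h1⟩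
  have hdhi : (a, j) ∈ d.cells := by
    rw [show (a, j) = d.hi from Prod.ext (by simp only; omega) h2]; exact d.hi_mem
  obtain ⟨f, hf, hfc⟩ := T.exists_domino (c := (a, j + 1))
    (lam.up_left_mem (Nat.le_succ a) le_rfl (T.isPaving.1 e he hec))
  have hfs : 0 ≤ f.station := station_nonneg_of_mem hfc (by simp [content]; omega)
  have hf1 := T.letter_le_of_row hd hds hf hfs (Nat.lt_succ_self j) hdhi hfc
  have hf2 := T.letter_le_of_col hf hfs he hes (Nat.lt_succ_self a) hfc hec
  have hf3 : (T.entry f).minLetter = (T.entry d).minLetter :=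
    le_antisymm (hf2.trans heq.ge) hf1
  have hfe := T.eq_of_unprimed_of_col hf hfs he hes hfc hec (hf3.trans heq) (by rwa [hf3])
  subst hfe
  rcases Domino.content_of_mem hfc with h | h <;> simp [content] at h <;> omega

/-- Keys strictly increase from a domino to a different domino below it. If the letters agree
and are primed, the stations could only fail to decrease if both dominoes were horizontal and
staggered, and then the domino right of the first one would repeat the letter in its row. -/
theorem eq_or_dominoKey_lt_down {d e : Domino} (hd : d ∈ T.paving) (he : e ∈ T.paving)
    {i j : ℕ} (hij : i + 1 ≤ j) (hdc : (i, j) ∈ d.cells) (hec : (i + 1, j) ∈ e.cells) :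
    d = e ∨ T.dominoKey d < T.dominoKey e := by
  by_contra! hcon
  obtain ⟨hne, hcon⟩ := hcon
  refine absurd ?_ hcon.not_gt
  have hcd : content (i, j) = (j : ℤ) - i := rfl
  have hce : content (i + 1, j) = (j : ℤ) - (i + 1) := by simp [content]
  have hds : 0 ≤ d.station := station_nonneg_of_mem hdc (by omega)
  have hes : 0 ≤ e.station := station_nonneg_of_mem hec (by omega)
  have hle := T.letter_le_of_col hd hds he hes (Nat.lt_succ_self i) hdc hec
  rw [dominoKey, dominoKey, key_lt_key_iff]
  rcases hle.lt_or_eq with hlt | heq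
  · exact Or.inl hlt
  refine Or.inr ⟨heq, fun hp => ?_,
    fun hp => absurd (T.eq_of_unprimed_of_col hd hds he hes hdc hec heq hp) hne⟩
  by_contra hst
  have hd1 := Domino.content_of_mem hdc
  have he1 := Domino.content_of_mem hec
  have helo : (i + 1, j) = e.lo := Domino.eq_lo_of_mem hec (by omega)
  rcases e.hi_lo_cases with ⟨h1, h2⟩ | ⟨h1, h2⟩
  swap
  · rw [← helo] at h1 h2
    exact hne (T.isPaving.eq_of_mem hd he hdc
      (by rw [show (i, j) = e.hi from Prod.ext (by simp only at h1 ⊢; omega) h2]; exact e.hi_mem))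
  rw [← helo] at h1 h2
  have hehi : (i + 1, j + 1) ∈ e.cells := by
    rw [show (i + 1, j + 1) = e.hi from Prod.ext h1 h2]; exact e.hi_mem
  obtain ⟨f, hf, hfc⟩ := T.exists_domino (c := (i, j + 1))
    (lam.up_left_mem (Nat.le_succ i) le_rfl (T.isPaving.1 e he hehi))
  have hfs : 0 ≤ f.station := station_nonneg_of_mem hfc (by simp [content]; omega)
  have hf1 := T.letter_le_of_row hd hds hf hfs (Nat.lt_succ_self j) hdc hfc
  have hf2 := T.letter_le_of_col hf hfs he hes (Nat.lt_succ_self i) hfc hehi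
  have hf3 : (T.entry d).minLetter = (T.entry f).minLetter :=
    le_antisymm hf1 (hf2.trans heq.ge)
  have hfe := T.eq_of_primed_of_row hd hds hf hfs hdc hfc hf3 hp
  subst hfe
  rcases Domino.content_of_mem hfc with h | h <;> simp [content] at h <;> omega

/-- The domino on a box of the partition. -/
noncomputable def dominoAt (c : ℕ × ℕ) : Domino :=
  open Classical in
  if h : c ∈ lam then (T.exists_domino h).choose else Domino.horiz 0 0

theorem dominoAt_mem {c : ℕ × ℕ} (hc : c ∈ lam) : T.dominoAt c ∈ T.paving := by
  rw [dominoAt, dif_pos hc]; exact (T.exists_domino hc).choose_spec.1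

theorem mem_dominoAt {c : ℕ × ℕ} (hc : c ∈ lam) : c ∈ (T.dominoAt c).cells := by
  rw [dominoAt, dif_pos hc]; exact (T.exists_domino hc).choose_spec.2

theorem dominoAt_eq {c : ℕ × ℕ} {d : Domino} (hd : d ∈ T.paving) (hc : c ∈ d.cells) :
    T.dominoAt c = d :=
  T.isPaving.eq_of_mem (T.dominoAt_mem (T.isPaving.1 d hd hc)) hd
    (T.mem_dominoAt (T.isPaving.1 d hd hc)) hc

/-- The key on the `p`-th box of the diagonal `D_j`. -/
noncomputable def cellKey (j p : ℕ) : Letter ×ₗ ℤ := T.dominoKey (T.dominoAt (p, p + j))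

theorem cellKey_eq {d : Domino} (hd : d ∈ T.paving) {j p : ℕ} (hc : (p, p + j) ∈ d.cells) :
    T.cellKey j p = T.dominoKey d := by rw [cellKey, T.dominoAt_eq hd hc]

theorem cellKey_right {j p : ℕ} (h : p < diagLen lam (j + 1)) :
    T.dominoAt (p, p + j) = T.dominoAt (p, p + (j + 1)) ∨ T.cellKey j p < T.cellKey (j + 1) p := by
  have h2 := lt_diagLen_iff.1 h
  have h1 := lt_diagLen_iff.1 (h.trans_le (diagLen_succ_le lam j))
  exact T.eq_or_dominoKey_lt_right (T.dominoAt_mem h1) (T.dominoAt_mem h2) (by omega)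
    (T.mem_dominoAt h1) (T.mem_dominoAt h2)

theorem cellKey_down {j p : ℕ} (h : p + 1 < diagLen lam j) :
    T.dominoAt (p, p + (j + 1)) = T.dominoAt (p + 1, p + 1 + j) ∨
      T.cellKey (j + 1) p < T.cellKey j (p + 1) := by
  have h2 := lt_diagLen_iff.1 h
  have h1 := lt_diagLen_iff.1 (show p < diagLen lam (j + 1) by
    have := diagLen_le_succ lam j; omega)
  refine T.eq_or_dominoKey_lt_down (i := p) (j := p + (j + 1)) (T.dominoAt_mem h1)
    (T.dominoAt_mem h2) (by omega) (T.mem_dominoAt h1) ?_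
  have := T.mem_dominoAt h2
  rwa [show p + 1 + j = p + (j + 1) by omega] at this ⊢

theorem cellKey_le_right {j p : ℕ} (h : p < diagLen lam (j + 1)) :
    T.cellKey j p ≤ T.cellKey (j + 1) p := by
  rcases T.cellKey_right h with h | h
  · rw [cellKey, h]; rfl
  · exact h.le

theorem cellKey_le_down {j p : ℕ} (h : p + 1 < diagLen lam j) :
    T.cellKey (j + 1) p ≤ T.cellKey j (p + 1) := by
  rcases T.cellKey_down h with h | h
  · rw [cellKey, h]; rfl
  · exact h.le

theorem cellKey_lt_succ {j p : ℕ} (h : p + 1 < diagLen lam j) :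
    T.cellKey j p < T.cellKey j (p + 1) := by
  have h' : p < diagLen lam (j + 1) := by have := diagLen_le_succ lam j; omega
  rcases T.cellKey_right h' with h1 | h1
  · rcases T.cellKey_down h with h2 | h2
    · have ha := T.mem_dominoAt (lt_diagLen_iff.1 (show p < diagLen lam j by omega))
      have hb := T.mem_dominoAt (lt_diagLen_iff.1 h)
      rw [← h2, ← h1] at hb
      have := Domino.eq_of_content_eq ha hb (by simp [content])
      simp at this
    · exact (T.cellKey_le_right h').trans_lt h2
  · exact h1.trans_le (T.cellKey_le_down h)

theorem cellKey_lt {j p p' : ℕ} (hp : p < p') (h : p' < diagLen lam j) :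
    T.cellKey j p < T.cellKey j p' := by
  induction p', hp using Nat.le_induction with
  | base => exact T.cellKey_lt_succ h
  | succ p' _ ih => exact (ih (by omega)).trans (T.cellKey_lt_succ h)

theorem exists_hi_eq {d : Domino} {m : ℕ} (hm : d.station = m) : ∃ p, d.hi = (p, p + m) := by
  refine ⟨d.hi.1, Prod.ext rfl ?_⟩
  have := d.content_hi
  simp only [content] at this ⊢
  omega

theorem exists_lo_eq {d : Domino} {m : ℕ} (hm : d.station = m + 1) : ∃ p, d.lo = (p, p + m) := by
  refine ⟨d.lo.1, Prod.ext rfl ?_⟩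
  have := d.content_lo
  simp only [content] at this ⊢
  omega

theorem eq_of_dominoKey_eq {d e : Domino} (hd : d ∈ T.paving) (hds : 0 ≤ d.station)
    (he : e ∈ T.paving) (h : T.dominoKey d = T.dominoKey e) : d = e := by
  have hs : d.station = e.station := (key_inj.1 h).2
  obtain ⟨m, hm⟩ := Int.eq_ofNat_of_zero_le hds
  obtain ⟨p, hp⟩ := exists_hi_eq hm
  obtain ⟨p', hp'⟩ := exists_hi_eq (hs ▸ hm)
  have hpc : (p, p + m) ∈ d.cells := hp ▸ d.hi_mem
  have hpc' : (p', p' + m) ∈ e.cells := hp' ▸ e.hi_mem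
  have hl := lt_diagLen_iff.2 (T.isPaving.1 d hd hpc)
  have hl' := lt_diagLen_iff.2 (T.isPaving.1 e he hpc')
  rw [← T.cellKey_eq hd hpc, ← T.cellKey_eq he hpc'] at h
  have : p = p' := by
    by_contra hne
    rcases Nat.lt_or_gt_of_ne hne with hlt | hlt
    · exact (T.cellKey_lt hlt hl').ne h
    · exact (T.cellKey_lt hlt hl).ne' h
  subst this
  exact T.isPaving.eq_of_mem hd he hpc hpc'

/-! ### Counting keys in a tableau -/

open Classical in
/-- The number of dominoes of station `m` with key smaller than `κ`. -/
noncomputable def keyCount (m : ℕ) (κ : Letter ×ₗ ℤ) : ℕ :=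
  (T.paving.filter fun d => d.station = (m : ℤ) ∧ T.dominoKey d < κ).card

/-- The number of boxes on `D_j` with key smaller than `κ`. -/
noncomputable def cellCount (j : ℕ) (κ : Letter ×ₗ ℤ) : ℕ :=
  ((Finset.range (diagLen lam j)).filter fun p => T.cellKey j p < κ).card

theorem lt_cellCount_iff {j p : ℕ} {κ : Letter ×ₗ ℤ} :
    p < T.cellCount j κ ↔ p < diagLen lam j ∧ T.cellKey j p < κ := by
  refine lt_card_filter_range_iff' fun p p' hp hp' h => ?_
  rcases hp.lt_or_eq with hlt | rfl
  · exact (T.cellKey_lt hlt hp').trans h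
  · exact h

theorem cellCount_dominoKey {d : Domino} (hd : d ∈ T.paving) {j p : ℕ}
    (hc : (p, p + j) ∈ d.cells) : T.cellCount j (T.dominoKey d) = p := by
  have hl := lt_diagLen_iff.2 (T.isPaving.1 d hd hc)
  rw [← T.cellKey_eq hd hc]
  refine le_antisymm ?_ ?_
  · by_contra hn
    exact lt_irrefl _ (T.lt_cellCount_iff.1 (not_le.1 hn)).2
  · by_contra hn
    have hlt := not_le.1 hn
    exact lt_irrefl _ (T.lt_cellCount_iff.2 ⟨hlt.trans hl, T.cellKey_lt hlt hl⟩)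

theorem cellCount_succ_le (j : ℕ) (κ : Letter ×ₗ ℤ) : T.cellCount (j + 1) κ ≤ T.cellCount j κ := by
  by_contra hn
  obtain ⟨h1, h2⟩ := T.lt_cellCount_iff.1 (not_le.1 hn)
  exact lt_irrefl _ (T.lt_cellCount_iff.2
    ⟨h1.trans_le (diagLen_succ_le lam j), (T.cellKey_le_right h1).trans_lt h2⟩)

theorem cellCount_le_succ (j : ℕ) (κ : Letter ×ₗ ℤ) :
    T.cellCount j κ ≤ T.cellCount (j + 1) κ + 1 := by
  by_contra hn
  obtain ⟨h1, h2⟩ := T.lt_cellCount_iff.1 (not_le.1 hn)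
  have h3 : T.cellCount (j + 1) κ < diagLen lam (j + 1) := by
    have := diagLen_le_succ lam j
    omega
  exact lt_irrefl _ (T.lt_cellCount_iff.2 ⟨h3, (T.cellKey_le_down h1).trans_lt h2⟩)

theorem cellCount_eq (j : ℕ) (κ : Letter ×ₗ ℤ) :
    T.cellCount j κ = T.keyCount j κ + T.keyCount (j + 1) κ := by
  classical
  have hdisj : Disjoint (T.paving.filter fun d => d.station = ((j : ℕ) : ℤ) ∧ T.dominoKey d < κ)
      (T.paving.filter fun d => d.station = ((j + 1 : ℕ) : ℤ) ∧ T.dominoKey d < κ) := by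
    rw [Finset.disjoint_filter]
    rintro d _ ⟨h, -⟩ ⟨h', -⟩
    omega
  rw [keyCount, keyCount, ← Finset.card_union_of_disjoint hdisj, ← Finset.filter_or, cellCount]
  refine Finset.card_bij (fun p _ => T.dominoAt (p, p + j)) ?_ ?_ ?_
  · intro p hp
    rw [Finset.mem_filter, Finset.mem_range] at hp
    have hc := lt_diagLen_iff.1 hp.1
    refine Finset.mem_filter.2 ⟨T.dominoAt_mem hc, ?_⟩
    have : content (p, p + j) = (j : ℤ) := by simp [content]
    rcases Domino.content_of_mem (T.mem_dominoAt hc) with h | h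
    · exact Or.inl ⟨by omega, hp.2⟩
    · exact Or.inr ⟨by push_cast; omega, hp.2⟩
  · intro p hp p' hp' he
    rw [Finset.mem_filter, Finset.mem_range] at hp hp'
    have h1 := T.mem_dominoAt (lt_diagLen_iff.1 hp.1)
    have h2 := T.mem_dominoAt (lt_diagLen_iff.1 hp'.1)
    rw [← he] at h2
    exact (Prod.ext_iff.1 (Domino.eq_of_content_eq h1 h2 (by simp [content]))).1
  · intro d hd
    rw [Finset.mem_filter] at hd
    obtain ⟨p, hp⟩ : ∃ p, (p, p + j) ∈ d.cells := by
      rcases hd.2 with h | h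
      · obtain ⟨p, hp⟩ := exists_hi_eq h.1
        exact ⟨p, hp ▸ d.hi_mem⟩
      · obtain ⟨p, hp⟩ := exists_lo_eq (m := j) (d := d) (by rw [h.1]; push_cast; rfl)
        exact ⟨p, hp ▸ d.lo_mem⟩
    refine ⟨p, Finset.mem_filter.2 ⟨Finset.mem_range.2
      (lt_diagLen_iff.2 (T.isPaving.1 d hd.1 hp)), ?_⟩, T.dominoAt_eq hd.1 hp⟩
    rw [T.cellKey_eq hd.1 hp]
    rcases hd.2 with h | h <;> exact h.2

theorem keyCount_mono (m : ℕ) {κ κ' : Letter ×ₗ ℤ} (h : κ ≤ κ') :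
    T.keyCount m κ ≤ T.keyCount m κ' :=
  Finset.card_le_card (Finset.monotone_filter_right _ fun _ _ h' => ⟨h'.1, lt_of_lt_of_le h'.2 h⟩)

theorem keyCount_lt {d : Domino} (hd : d ∈ T.paving) {m : ℕ} (hm : d.station = m)
    {κ : Letter ×ₗ ℤ} (hκ : T.dominoKey d < κ) : T.keyCount m (T.dominoKey d) < T.keyCount m κ := by
  classical
  refine Finset.card_lt_card (Finset.ssubset_iff.2 ⟨d, ?_, ?_⟩)
  · simp
  · intro e he
    rcases Finset.mem_insert.1 he with rfl | he
    · exact Finset.mem_filter.2 ⟨hd, hm, hκ⟩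
    · rw [Finset.mem_filter] at he ⊢
      exact ⟨he.1, he.2.1, he.2.2.trans hκ⟩

theorem keyCount_lt_stationCount {d : Domino} (hd : d ∈ T.paving) {m : ℕ} (hm : d.station = m) :
    T.keyCount m (T.dominoKey d) < stationCount T.paving m := by
  classical
  refine Finset.card_lt_card (Finset.ssubset_iff.2 ⟨d, ?_, ?_⟩)
  · simp
  · intro e he
    rcases Finset.mem_insert.1 he with rfl | he
    · exact Finset.mem_filter.2 ⟨hd, hm⟩
    · rw [Finset.mem_filter] at he ⊢
      exact ⟨he.1, he.2.1⟩

theorem eq_of_keyCount_eq {d e : Domino} (hd : d ∈ T.paving) (he : e ∈ T.paving) {m : ℕ}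
    (hdm : d.station = m) (hem : e.station = m)
    (h : T.keyCount m (T.dominoKey d) = T.keyCount m (T.dominoKey e)) : d = e := by
  refine T.eq_of_dominoKey_eq hd (by omega) he ?_
  by_contra hne
  rcases lt_or_gt_of_ne hne with hlt | hlt
  · exact (T.keyCount_lt hd hdm hlt).ne h
  · exact (T.keyCount_lt he hem hlt).ne' h

/-- The dominoes of station `m` are numbered by the counts of smaller keys. -/
theorem exists_keyCount_eq {m i : ℕ} (hi : i < stationCount T.paving m) :
    ∃ d, d ∈ T.paving ∧ d.station = m ∧ T.keyCount m (T.dominoKey d) = i := by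
  classical
  have hsurj := Finset.surjOn_of_injOn_of_card_le
    (s := T.paving.filter fun d => d.station = (m : ℤ))
    (t := Finset.range (stationCount T.paving m)) (fun d => T.keyCount m (T.dominoKey d))
    (fun d hd => by
      have hd := Finset.mem_filter.1 (Finset.mem_coe.1 hd)
      exact Finset.mem_coe.2 (Finset.mem_range.2 (T.keyCount_lt_stationCount hd.1 hd.2)))
    (fun d hd e he hde => by
      have hd := Finset.mem_filter.1 (Finset.mem_coe.1 hd)
      have he := Finset.mem_filter.1 (Finset.mem_coe.1 he)
      exact T.eq_of_keyCount_eq hd.1 he.1 hd.2 he.2 hde)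
    (by rw [Finset.card_range, stationCount])
  obtain ⟨d, hd, he⟩ := hsurj (Finset.mem_coe.2 (Finset.mem_range.2 hi))
  have hd := Finset.mem_filter.1 (Finset.mem_coe.1 hd)
  exact ⟨d, hd.1, hd.2, he⟩

theorem keyCount_add_two_le (m : ℕ) (κ : Letter ×ₗ ℤ) : T.keyCount (m + 2) κ ≤ T.keyCount m κ := by
  have h := T.cellCount_succ_le m κ
  have h1 := T.cellCount_eq m κ
  have h2 : T.cellCount (m + 1) κ = T.keyCount (m + 1) κ + T.keyCount (m + 2) κ :=
    T.cellCount_eq (m + 1) κ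
  omega

theorem keyCount_le_add_two (m : ℕ) (κ : Letter ×ₗ ℤ) :
    T.keyCount m κ ≤ T.keyCount (m + 2) κ + 1 := by
  have h := T.cellCount_le_succ m κ
  have h1 := T.cellCount_eq m κ
  have h2 : T.cellCount (m + 1) κ = T.keyCount (m + 1) κ + T.keyCount (m + 2) κ :=
    T.cellCount_eq (m + 1) κ
  omega

theorem hi_eq_keyCount {d : Domino} (hd : d ∈ T.paving) {m : ℕ} (hm : d.station = m) :
    d.hi = (T.keyCount m (T.dominoKey d) + T.keyCount (m + 1) (T.dominoKey d),
      T.keyCount m (T.dominoKey d) + T.keyCount (m + 1) (T.dominoKey d) + m) := by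
  obtain ⟨p, hp⟩ := exists_hi_eq hm
  rw [← T.cellCount_eq, T.cellCount_dominoKey hd (hp ▸ d.hi_mem), hp]

theorem lo_eq_keyCount {d : Domino} (hd : d ∈ T.paving) {m : ℕ} (hm : d.station = m + 1) :
    d.lo = (T.keyCount m (T.dominoKey d) + T.keyCount (m + 1) (T.dominoKey d),
      T.keyCount m (T.dominoKey d) + T.keyCount (m + 1) (T.dominoKey d) + m) := by
  obtain ⟨p, hp⟩ := exists_lo_eq hm
  rw [← T.cellCount_eq, T.cellCount_dominoKey hd (hp ▸ d.lo_mem), hp]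

/-! ### Dominoes on the main diagonal -/

/-- All dominoes on `D_0` that precede a vertical domino of station `0` are vertical of
station `0`. -/
theorem lo_eq_of_le {p : ℕ} {d : Domino} (hd : d ∈ T.paving) (hhi : d.hi = (p, p))
    (hlo : d.lo = (p + 1, p)) {p' : ℕ} (hp : p' ≤ p) :
    ∃ e ∈ T.paving, e.hi = (p', p') ∧ e.lo = (p' + 1, p') := by
  induction hp using Nat.decreasingInduction with
  | self => exact ⟨d, hd, hhi, hlo⟩
  | of_succ k hk ih =>
    obtain ⟨d, hd, hhi, hlo⟩ := ih
    have hs : d.station = 0 := by rw [← d.content_hi, hhi]; simp [content]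
    obtain ⟨f, hf, hfc⟩ := T.exists_domino (c := (k + 1, k))
      (lam.up_left_mem le_rfl (Nat.le_succ k) (hhi ▸ T.isPaving.hi_mem hd))
    by_contra hcon
    refine T.isShiftedPaving.no_bad_vertical ⟨d, hd, ?_, ?_, ⟨f, hf, (k + 1, k), hfc,
      (k + 1, k + 1), hhi ▸ d.hi_mem, rfl, rfl⟩, ?_⟩
    · rw [Domino.isVertical_iff, hhi, hlo]
    · rw [Domino.diagonal_eq, hs]; rfl
    · rintro e he ⟨c, hce, b, hbd, h1, h2⟩
      rw [Domino.diagonal_neg_iff]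
      by_contra hes
      rw [Domino.mem_cells, hhi, hlo] at hbd
      have hc2 : c.2 = k := by rcases hbd with rfl | rfl <;> simp only at h2 <;> omega
      have hcc : content c = (k : ℤ) - c.1 := by rw [content, hc2]
      have hces := Domino.content_of_mem hce
      have hc1 : c.1 = k + 1 := by
        rcases hbd with rfl | rfl <;> simp only at h1 <;> push_cast [h1] at hcc <;> omega
      have hc : c = e.lo := Domino.eq_lo_of_mem hce (by rw [hc1] at hcc; push_cast at hcc; omega)
      rcases e.hi_lo_cases with ⟨h3, h4⟩ | ⟨h3, h4⟩
      · have : e.hi = d.hi := by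
          rw [hhi]
          exact Prod.ext (by rw [← h3, ← hc, hc1]) (by rw [← h4, ← hc, hc2])
        have hed := T.isPaving.eq_of_mem he hd e.hi_mem (this ▸ d.hi_mem)
        rw [hed, hlo] at hc
        rw [hc] at hc1
        simp at hc1
      · refine hcon ⟨e, he, Prod.ext ?_ ?_, ?_⟩
        · rw [← hc, hc1] at h3; simp only; omega
        · rw [← hc, hc2] at h4; exact h4.symm
        · rw [← hc]; exact Prod.ext hc1 hc2

/-- If only dominoes of station `0` meet the first boxes of `D_0`, then they are vertical. -/
theorem lo_eq_of_station {p : ℕ}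
    (h : ∀ p' ≤ p, ∃ d ∈ T.paving, d.station = 0 ∧ d.hi = (p', p')) {d : Domino}
    (hd : d ∈ T.paving) (hhi : d.hi = (p, p)) : d.lo = (p + 1, p) := by
  induction p generalizing d with
  | zero =>
    rcases d.hi_lo_cases with ⟨h3, h4⟩ | ⟨h3, h4⟩
    · rw [hhi] at h4; simp at h4
    · rw [hhi] at h3 h4; exact Prod.ext h3 h4
  | succ p ih =>
    obtain ⟨e, he, -, hehi⟩ := h p (Nat.le_succ p)
    have helo := ih (fun p' hp' => h p' (by omega)) he hehi
    rcases d.hi_lo_cases with ⟨h3, h4⟩ | ⟨h3, h4⟩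
    · rw [hhi] at h3 h4
      have hdlo : d.lo = e.lo := by
        rw [helo]; exact Prod.ext h3 (by simp only at h4 ⊢; omega)
      have := T.isPaving.eq_of_mem hd he d.lo_mem (hdlo ▸ e.lo_mem)
      rw [this, hehi] at hhi
      simp at hhi
    · rw [hhi] at h3 h4; exact Prod.ext h3 h4

theorem lo_row_of_station_zero {d : Domino} (hd : d ∈ T.paving) (hs : d.station = 0) :
    d.lo.1 = T.keyCount 0 (T.dominoKey d) + max 1 (T.keyCount 1 (T.dominoKey d)) := by
  classical
  have hhi := T.hi_eq_keyCount (m := 0) hd (by simpa using hs)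
  simp only [zero_add, add_zero] at hhi
  set p := T.keyCount 0 (T.dominoKey d) + T.keyCount 1 (T.dominoKey d) with hp
  have hpd : T.cellCount 0 (T.dominoKey d) = p := T.cellCount_eq 0 _
  by_cases h1 : T.keyCount 1 (T.dominoKey d) = 0
  · have hlo : d.lo = (p + 1, p) := by
      refine T.lo_eq_of_station (fun p' hp' => ?_) hd hhi
      rcases hp'.lt_or_eq with hlt | rfl
      · rw [← hpd, T.lt_cellCount_iff] at hlt
        have hc := lt_diagLen_iff.1 hlt.1
        have hmem := T.mem_dominoAt hc
        have h0 : content (p', p' + 0) = 0 := by simp [content]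
        have hst : (T.dominoAt (p', p' + 0)).station = 0 := by
          rcases Domino.content_of_mem hmem with h | h
          · rw [← h, h0]
          · exfalso
            rw [keyCount, Finset.card_eq_zero, Finset.filter_eq_empty_iff] at h1
            exact h1 (T.dominoAt_mem hc) ⟨by push_cast; omega, hlt.2⟩
        exact ⟨_, T.dominoAt_mem hc, hst, (Domino.eq_hi_of_mem hmem (by rw [hst, h0])).symm⟩
      · exact ⟨d, hd, hs, hhi⟩
    rw [hlo]
    simp only
    omega
  · have hlo : d.lo.1 = p := by
      rcases d.hi_lo_cases with ⟨h3, -⟩ | ⟨h3, h4⟩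
      · rw [h3, hhi]
      · exfalso
        rw [keyCount, Finset.card_eq_zero, Finset.filter_eq_empty_iff] at h1
        push Not at h1
        obtain ⟨e, he, hes, hek⟩ := h1
        obtain ⟨p', hp'⟩ := exists_lo_eq (m := 0) (d := e) (by simpa using hes)
        have hlt : p' < p := by
          rw [← hpd, T.lt_cellCount_iff]
          exact ⟨lt_diagLen_iff.2 (hp' ▸ T.isPaving.lo_mem he),
            by rwa [T.cellKey_eq he (hp' ▸ e.lo_mem)]⟩
        rw [hhi] at h3 h4
        obtain ⟨f, hf, hfhi, -⟩ := T.lo_eq_of_le hd hhi (Prod.ext h3 h4) hlt.le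
        have hfe := T.isPaving.eq_of_mem hf he f.hi_mem (by
          rw [hfhi]; exact hp' ▸ e.lo_mem)
        have := f.content_hi
        rw [hfhi, hfe, hes] at this
        simp [content] at this
    rw [hlo]
    omega

/-! ### The diagonal system of a tableau -/

/-- The dominoes of a tableau weakly above `D_0` are the dominoes of a diagonal system: they are
placed by the ranks of their keys. -/
theorem exists_system {n : ℕ → ℕ} (hn : ∀ m, n m = stationCount T.paving m) :
    ∃ w, IsDiagonalSystem n w ∧ T.up = systemUp n w := by
  classical
  have hex : ∀ m i, ∃ d, i < n m →
      d ∈ T.paving ∧ d.station = m ∧ T.keyCount m (T.dominoKey d) = i := by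
    intro m i
    by_cases hi : i < n m
    · obtain ⟨d, hd⟩ := T.exists_keyCount_eq (hn m ▸ hi)
      exact ⟨d, fun _ => hd⟩
    · exact ⟨Domino.horiz 0 0, fun h => absurd h hi⟩
  choose D hD using hex
  have hDmem : ∀ {m i}, i < n m → D m i ∈ T.paving := fun h => (hD _ _ h).1
  have hDst : ∀ {m i}, i < n m → (D m i).station = m := fun h => (hD _ _ h).2.1
  have hDct : ∀ {m i}, i < n m → T.keyCount m (T.dominoKey (D m i)) = i := fun h => (hD _ _ h).2.2
  let w : ℕ → ℕ → SetEntry := fun m i => T.entry (D m i)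
  have hkey : ∀ {m i}, i < n m → nodeKey w m i = T.dominoKey (D m i) := by
    intro m i hi
    rw [dominoKey, hDst hi]
    rfl
  have hfill : ∀ {m i}, i < n m → T.fill (D m i) = some (w m i) := fun {m i} hi =>
    T.fill_eq_some_entry (hDmem hi) (by rw [hDst hi]; positivity)
  have hDeq : ∀ {d : Domino} {m : ℕ}, d ∈ T.paving → d.station = m →
      ∃ i < n m, d = D m i := by
    intro d m hd hm
    have hlt : T.keyCount m (T.dominoKey d) < n m := hn m ▸ T.keyCount_lt_stationCount hd hm
    exact ⟨_, hlt, T.eq_of_keyCount_eq hd (hDmem hlt) hm (hDst hlt) (hDct hlt).symm⟩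
  have hlen : ∀ j, diagLen lam j = n j + n (j + 1) := fun j => by
    rw [hn, hn, T.isPaving.diagLen_eq]; push_cast; rfl
  have hle : ∀ m, n (m + 2) ≤ n m := fun m => by
    have h1 := diagLen_succ_le lam m
    have h2 := hlen m
    have h3 : diagLen lam (m + 1) = n (m + 1) + n (m + 2) := hlen (m + 1)
    omega
  have hge : ∀ m, n m ≤ n (m + 2) + 1 := fun m => by
    have h1 := diagLen_le_succ lam m
    have h2 := hlen m
    have h3 : diagLen lam (m + 1) = n (m + 1) + n (m + 2) := hlen (m + 1)
    omega
  have htype : ∀ {m i i'}, i < n m → i' < n (m + 2) → (D m i).type = (D (m + 2) i').type := by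
    intro m i i' hi hi'
    rw [Domino.type_eq, Domino.type_eq, hDst hi, hDst hi']
    push_cast
    rw [show ((m : ℤ) + 2) % 2 = (m : ℤ) % 2 by omega]
  have hdiag : ∀ {m i i'}, i < n m → i' < n (m + 2) →
      (D (m + 2) i').diagonal = (D m i).diagonal + 1 := by
    intro m i i' hi hi'
    rw [Domino.diagonal_eq, Domino.diagonal_eq, hDst hi, hDst hi']
    push_cast
    omega
  have hsys : IsDiagonalSystem n w := by
    refine ⟨hle, hge, fun m i hi' => ?_, fun m i hi' => ?_⟩
    -- comparing ranks on `D_{m+1}` shows that the second domino is weakly southeast of the first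
    · have hi : i < n m := hi'.trans_le (hle m)
      have hk : T.dominoKey (D m i) ≤ T.dominoKey (D (m + 2) i) := by
        by_contra hlt
        have h1 := T.keyCount_lt (hDmem hi') (hDst hi') (not_le.1 hlt)
        have h2 := T.keyCount_add_two_le m (T.dominoKey (D m i))
        rw [hDct hi'] at h1
        rw [hDct hi] at h2
        omega
      have h1 := T.hi_eq_keyCount (hDmem hi) (hDst hi)
      have h2 := T.lo_eq_keyCount (m := m + 1) (hDmem hi') (by rw [hDst hi']; push_cast; ring)
      have h3 := T.keyCount_mono (m + 1) hk
      rw [hDct hi] at h1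
      rw [show m + 1 + 1 = m + 2 from rfl, hDct hi'] at h2
      refine T.east (D m i) (D (m + 2) i) _ _ (hfill hi) (hfill hi') (htype hi hi')
        ⟨(D (m + 2) i).lo, (D (m + 2) i).lo_mem, ?_, ?_⟩ (hdiag hi hi')
      · refine (Domino.topLeft_le_of_mem (D m i).hi_mem).1.trans ?_
        rw [h1, h2]; simp only; omega
      · refine (Domino.topLeft_le_of_mem (D m i).hi_mem).2.trans ?_
        rw [h1, h2]; simp only; omega
    · have hi : i < n (m + 2) := by have := hge m; omega
      have hk : T.dominoKey (D (m + 2) i) ≤ T.dominoKey (D m (i + 1)) := by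
        by_contra hlt
        have h1 := T.keyCount_lt (hDmem hi') (hDst hi') (not_le.1 hlt)
        have h2 := T.keyCount_le_add_two m (T.dominoKey (D (m + 2) i))
        rw [hDct hi'] at h1
        rw [hDct hi] at h2
        omega
      have h1 := T.lo_eq_keyCount (m := m + 1) (hDmem hi) (by rw [hDst hi]; push_cast; ring)
      have h2 := T.hi_eq_keyCount (hDmem hi') (hDst hi')
      have h3 := T.keyCount_mono (m + 1) hk
      rw [show m + 1 + 1 = m + 2 from rfl, hDct hi] at h1
      rw [hDct hi'] at h2
      refine T.south (D (m + 2) i) (D m (i + 1)) _ _ (hfill hi) (hfill hi') (htype hi' hi).symm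
        ⟨(D m (i + 1)).hi, (D m (i + 1)).hi_mem, ?_, ?_⟩ (hdiag hi' hi)
      · refine (Domino.topLeft_le_of_mem (D (m + 2) i).lo_mem).1.trans ?_
        rw [h1, h2]; simp only; omega
      · refine (Domino.topLeft_le_of_mem (D (m + 2) i).lo_mem).2.trans ?_
        rw [h1, h2]; simp only; omega
  have hcount : ∀ m κ, countLT n w m κ = T.keyCount m κ := by
    intro m κ
    refine Finset.card_bij (fun i _ => D m i) ?_ ?_ ?_
    · intro i hi
      rw [Finset.mem_filter, Finset.mem_range] at hi
      exact Finset.mem_filter.2 ⟨hDmem hi.1, hDst hi.1, hkey hi.1 ▸ hi.2⟩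
    · intro i hi i' hi' he
      rw [Finset.mem_filter, Finset.mem_range] at hi hi'
      rw [← hDct hi.1, he, hDct hi'.1]
    · intro d hd
      rw [Finset.mem_filter] at hd
      obtain ⟨i, hi, rfl⟩ := hDeq hd.1 hd.2.1
      exact ⟨i, Finset.mem_filter.2 ⟨Finset.mem_range.2 hi, (hkey hi).symm ▸ hd.2.2⟩, rfl⟩
  -- keys increase along each diagonal, so the position of a domino is the rank of its key
  have hnode : ∀ {m i}, i < n m → nodeDomino n w m i = D m i := by
    intro m i hi
    refine Domino.ext_hi_lo ?_ ?_
    · rw [hi_nodeDomino, T.hi_eq_keyCount (hDmem hi) (hDst hi), hkey hi]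
      simp only [rank, hcount]
    · rw [hsys.lo_nodeDomino, hkey hi]
      cases m with
      | zero =>
        have h1 := T.lo_row_of_station_zero (hDmem hi) (by simpa using hDst hi)
        have h2 : (D 0 i).lo.2 + 1 = (D 0 i).lo.1 := by
          have h := (D 0 i).content_lo
          rw [hDst hi] at h
          simp only [content] at h
          push_cast at h
          omega
        refine Prod.ext ?_ ?_
        · simp only [rank, hcount]; exact h1.symm
        · simp only [rank, hcount]; omega
      | succ m =>
        rw [T.lo_eq_keyCount (m := m) (hDmem hi) (by rw [hDst hi]; push_cast; rfl)]
        simp only [rank, hcount, Prod.mk.injEq, true_and]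
        omega
  refine ⟨w, hsys, Set.ext fun p => ⟨?_, ?_⟩⟩
  · rintro ⟨hp, hs, hf⟩
    rw [Domino.diagonal_nonneg_iff] at hs
    obtain ⟨m, hm⟩ := Int.eq_ofNat_of_zero_le hs
    obtain ⟨i, hi, hi'⟩ := hDeq hp hm
    refine ⟨m, i, hi, Prod.ext (by rw [hnode hi, hi']) ?_⟩
    rw [hi', hfill hi] at hf
    exact (Option.some.inj hf).symm
  · rintro ⟨m, i, hi, rfl⟩
    rw [hnode hi]
    refine ⟨hDmem hi, Domino.diagonal_nonneg_iff.2 ?_, hfill hi⟩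
    simp only [hDst hi]
    positivity

end ShiftedSetDominoTableau

/-! ### Paving the part below the main diagonal -/

/-- The part of a pavable partition on the diagonals `D_{-m}, D_{-m-1}, …` remains pavable after the
removal of any set of boxes on `D_{-m}` that is as large as the set of those boxes which the given
paving matches with boxes on `D_{1-m}`. The remaining boxes on `D_{-m}` are matched with boxes on
`D_{-m-1}`, downwards if they are above a suitable removed box and to the left if they are
below it; the boxes used on `D_{-m-1}` are the removed boxes of the next step. -/
theorem IsPaving.exists_paving_below {lam : YoungDiagram} {P : Finset Domino}
    (hP : IsPaving lam P) (m : ℕ) (Z : Finset ℕ)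
    (hZ : Z ⊆ Finset.range (diagLen lam.transpose m)) (hcard : Z.card = stationCount P (1 - m)) :
    ∃ Q : Finset Domino,
      (∀ d ∈ Q, d.station ≤ -m ∧ d.cells ⊆ lam.cells ∧ ∀ j ∈ Z, (j + m, j) ∉ d.cells) ∧
      ∀ c ∈ lam.cells, content c ≤ -m → (∀ j ∈ Z, c ≠ (j + m, j)) → ∃! d, d ∈ Q ∧ c ∈ d.cells := by
  classical
  obtain ⟨k, hk⟩ : ∃ k, lam.colLen 0 ≤ m + k := ⟨_, Nat.le_add_left _ _⟩
  induction k generalizing m Z with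
  | zero =>
    refine ⟨∅, by simp, fun c hc hcm _ => ?_⟩
    have h1 : (c.1, 0) ∈ lam := lam.up_left_mem le_rfl (Nat.zero_le _) hc
    rw [YoungDiagram.mem_iff_lt_colLen] at h1
    simp only [content] at hcm
    omega
  | succ k ih =>
    set l := diagLen lam.transpose m with hl
    set l' := diagLen lam.transpose (m + 1) with hl'
    have hll : l = stationCount P (1 - m) + stationCount P (1 - (m + 1)) :=
      hP.diagLen_transpose_eq m
    have hll' : l' = stationCount P (1 - (m + 1)) + stationCount P (1 - (m + 1 + 1)) := by
      have := hP.diagLen_transpose_eq (m + 1)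
      push_cast at this
      exact this
    have hle : l' ≤ l := diagLen_succ_le _ _
    have hge : l ≤ l' + 1 := diagLen_le_succ _ _
    set Y := Finset.range l \ Z with hY
    have hYmem : ∀ j, j ∈ Y ↔ j < l ∧ j ∉ Z := fun j => by simp [hY]
    have hYcard : Y.card = stationCount P (1 - (m + 1)) := by
      rw [hY, Finset.card_sdiff_of_subset hZ, Finset.card_range]
      omega
    -- the pivot `s` is a removed box if `D_{-m-1}` is shorter than `D_{-m}`, and lies beyond the
    -- end of `D_{-m}` otherwise
    obtain ⟨s, hsY, hs1, hs2⟩ : ∃ s, s ∉ Y ∧ (∀ j ∈ Y, j < s → j < l') ∧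
        ∀ j ∈ Y, s < j → j - 1 < l' := by
      rcases hle.lt_or_eq with hlt | heq
      · have hne : Z.Nonempty := by rw [← Finset.card_pos]; omega
        obtain ⟨s, hs⟩ := hne
        have hsl := Finset.mem_range.1 (hZ hs)
        refine ⟨s, fun h => ((hYmem s).1 h).2 hs, fun j _ hjs => by omega, fun j hj hjs => ?_⟩
        have := ((hYmem j).1 hj).1
        omega
      · refine ⟨l, fun h => lt_irrefl _ ((hYmem l).1 h).1, fun j hj _ => ?_, fun j hj hjs => ?_⟩
        · have := ((hYmem j).1 hj).1; omega
        · have := ((hYmem j).1 hj).1; omega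
    have hsne : ∀ j ∈ Y, j ≠ s := fun j hj h => hsY (h ▸ hj)
    let φ : ℕ → ℕ := fun j => if j < s then j else j - 1
    let D : ℕ → Domino := fun j =>
      if j < s then Domino.vert (j + m) j else Domino.horiz (j + m) (j - 1)
    have hφinj : ∀ j ∈ Y, ∀ j' ∈ Y, φ j = φ j' → j = j' := by
      intro j hj j' hj' h
      have h1 := hsne j hj
      have h2 := hsne j' hj'
      simp only [φ] at h
      split_ifs at h <;> omega
    have hφl : ∀ j ∈ Y, φ j < l' := by
      intro j hj
      have h1 := hsne j hj
      simp only [φ]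
      split_ifs with h
      · exact hs1 j hj h
      · exact hs2 j hj (by omega)
    have hDhi : ∀ j ∈ Y, (D j).hi = (j + m, j) := by
      intro j hj
      have h1 := hsne j hj
      simp only [D]
      split_ifs with h
      · rfl
      · simp only [Domino.hi, Prod.mk.injEq, true_and]; omega
    have hDlo : ∀ j ∈ Y, (D j).lo = (φ j + (m + 1), φ j) := by
      intro j hj
      have h1 := hsne j hj
      simp only [D, φ]
      split_ifs with h
      · simp only [Domino.lo, Prod.mk.injEq, and_true]; omega
      · simp only [Domino.lo, Prod.mk.injEq, and_true]; omega
    have hDst : ∀ j ∈ Y, (D j).station = -m := by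
      intro j hj
      rw [← Domino.content_hi, hDhi j hj, content]
      push_cast
      ring
    obtain ⟨Q, hQ1, hQ2⟩ := ih (m + 1) (Y.image φ)
      (fun x hx => by
        obtain ⟨j, hj, rfl⟩ := Finset.mem_image.1 hx
        exact Finset.mem_range.2 (hφl j hj))
      (by rw [Finset.card_image_of_injOn (fun j hj j' hj' h => hφinj j hj j' hj' h), hYcard]
          push_cast; rfl) (by omega)
    have hmem : ∀ d, d ∈ Y.image D ∪ Q ↔ (∃ j ∈ Y, D j = d) ∨ d ∈ Q := fun d => by
      rw [Finset.mem_union, Finset.mem_image]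
    refine ⟨Y.image D ∪ Q, fun d hd => ?_, fun c hc hcm hcZ => ?_⟩
    · rcases (hmem d).1 hd with ⟨j, hj, rfl⟩ | hd
      · refine ⟨(hDst j hj).le, fun c hc => ?_, fun j' hj' hc => ?_⟩
        · rcases Domino.mem_cells.1 hc with rfl | rfl
          · rw [hDhi j hj]
            exact lt_diagLen_transpose_iff.1 ((hYmem j).1 hj).1
          · rw [hDlo j hj]
            exact lt_diagLen_transpose_iff.1 (hφl j hj)
        · have := Domino.eq_hi_of_mem hc (by rw [hDst j hj, content]; push_cast; ring)
          rw [hDhi j hj] at this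
          have hjj : j' = j := (Prod.ext_iff.1 this).2
          exact ((hYmem j).1 hj).2 (hjj ▸ hj')
      · obtain ⟨h1, h2, -⟩ := hQ1 d hd
        push_cast at h1
        refine ⟨by omega, h2, fun j' hj' hc => ?_⟩
        have : content (j' + m, j') = -m := by rw [content]; push_cast; ring
        have := Domino.content_of_mem hc
        omega
    · obtain ⟨a, b⟩ := c
      by_cases h1 : content (a, b) = -m
      · obtain rfl : a = b + m := by simp only [content] at h1; omega
        have hbY : b ∈ Y := (hYmem b).2 ⟨lt_diagLen_transpose_iff.2 hc, fun hb => hcZ b hb rfl⟩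
        refine ⟨D b, ⟨(hmem _).2 (Or.inl ⟨b, hbY, rfl⟩), hDhi b hbY ▸ (D b).hi_mem⟩, ?_⟩
        rintro d ⟨hd, hcd⟩
        rcases (hmem d).1 hd with ⟨j, hj, rfl⟩ | hd
        · have := Domino.eq_hi_of_mem hcd (by rw [hDst j hj, h1])
          rw [hDhi j hj] at this
          rw [show b = j from (Prod.ext_iff.1 this).2]
        · have h2 := (hQ1 d hd).1
          have h3 := Domino.content_of_mem hcd
          push_cast at h2
          omega
      by_cases h2 : ∃ j ∈ Y, (a, b) = (φ j + (m + 1), φ j)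
      · obtain ⟨j, hj, hjc⟩ := h2
        refine ⟨D j, ⟨(hmem _).2 (Or.inl ⟨j, hj, rfl⟩), hjc ▸ hDlo j hj ▸ (D j).lo_mem⟩, ?_⟩
        rintro d ⟨hd, hcd⟩
        rcases (hmem d).1 hd with ⟨j', hj', rfl⟩ | hd
        · rcases Domino.mem_cells.1 hcd with h | h
          · exact absurd (by rw [h, Domino.content_hi, hDst j' hj']) h1
          · rw [hDlo j' hj', hjc] at h
            rw [hφinj j hj j' hj' (Prod.ext_iff.1 h).2]
        · exact absurd (hjc ▸ hcd) ((hQ1 d hd).2.2 _ (Finset.mem_image_of_mem φ hj))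
      · obtain ⟨d, ⟨hd, hcd⟩, huniq⟩ := hQ2 (a, b) hc (by push_cast; omega) (by
          intro x hx hxc
          obtain ⟨j, hj, rfl⟩ := Finset.mem_image.1 hx
          exact h2 ⟨j, hj, hxc⟩)
        refine ⟨d, ⟨(hmem _).2 (Or.inr hd), hcd⟩, ?_⟩
        rintro e ⟨he, hce⟩
        rcases (hmem e).1 he with ⟨j, hj, rfl⟩ | he
        · rcases Domino.mem_cells.1 hce with h | h
          · exact absurd (by rw [h, Domino.content_hi, hDst j hj]) h1
          · exact absurd ⟨j, hj, h.trans (hDlo j hj)⟩ h2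
        · exact huniq e ⟨he, hce⟩

/-! ### Comparing the nodes of a diagonal system by their boxes -/

theorem mem_nodeDomino_iff {n : ℕ → ℕ} {w : ℕ → ℕ → SetEntry} (h : IsDiagonalSystem n w)
    {m i j p : ℕ} : (p, p + j) ∈ (nodeDomino n w m i).cells ↔
      (m = j ∨ m = j + 1) ∧ rank n w (j + 1) (nodeKey w m i) = p := by
  rw [Domino.mem_cells, hi_nodeDomino, h.lo_nodeDomino, Prod.mk.injEq, Prod.mk.injEq]
  have h1 := one_le_rank_add (n := n) (w := w) m (nodeKey w m i)
  constructor
  · rintro (⟨h2, h3⟩ | ⟨h2, h3⟩)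
    · obtain rfl : m = j := by omega
      exact ⟨Or.inl rfl, h2.symm⟩
    · obtain rfl : m = j + 1 := by omega
      exact ⟨Or.inr rfl, h2.symm⟩
  · rintro ⟨rfl | rfl, h2⟩
    · exact Or.inl (by omega)
    · exact Or.inr (by omega)

theorem mem_nodeDomino_neg_iff {n : ℕ → ℕ} {w : ℕ → ℕ → SetEntry} (h : IsDiagonalSystem n w)
    {m i j : ℕ} : (j + 1, j) ∈ (nodeDomino n w m i).cells ↔
      m = 0 ∧ rank n w 0 (nodeKey w m i) = j + 1 := by
  rw [Domino.mem_cells, hi_nodeDomino, h.lo_nodeDomino, Prod.mk.injEq, Prod.mk.injEq]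
  constructor
  · rintro (⟨h2, h3⟩ | ⟨h2, h3⟩)
    · omega
    · obtain rfl : m = 0 := by omega
      exact ⟨rfl, h2.symm⟩
  · rintro ⟨rfl, h2⟩
    exact Or.inr (by omega)

/-- A box of a node lies on some `D_j` with `j ≥ 0`, or on `D_{-1}`. -/
theorem cases_of_mem_nodeDomino {n : ℕ → ℕ} {w : ℕ → ℕ → SetEntry} {m i : ℕ} {c : ℕ × ℕ}
    (hc : c ∈ (nodeDomino n w m i).cells) : (∃ p j, c = (p, p + j)) ∨ ∃ j, c = (j + 1, j) := by
  have h1 := Domino.content_of_mem hc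
  rw [station_nodeDomino] at h1
  obtain ⟨a, b⟩ := c
  simp only [content] at h1
  rcases le_or_gt a b with hab | hab
  · obtain ⟨j, rfl⟩ := Nat.exists_eq_add_of_le hab
    exact Or.inl ⟨a, j, rfl⟩
  · exact Or.inr ⟨b, Prod.ext (by simp only; omega) rfl⟩

namespace IsDiagonalSystem

variable {n : ℕ → ℕ} {w : ℕ → ℕ → SetEntry}

theorem rank_add_le (h : IsDiagonalSystem n w) (m d : ℕ) (κ : Letter ×ₗ ℤ) :
    rank n w (m + d) κ ≤ rank n w m κ := by
  induction d with
  | zero => exact le_rfl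
  | succ d ih => exact (h.rank_succ_le (m + d) κ).trans ih

theorem rank_le_add (h : IsDiagonalSystem n w) (m d : ℕ) (κ : Letter ×ₗ ℤ) :
    rank n w m κ ≤ rank n w (m + d) κ + d := by
  induction d with
  | zero => exact le_rfl
  | succ d ih =>
    have : rank n w (m + d) κ ≤ rank n w (m + (d + 1)) κ + 1 := h.rank_le_succ (m + d) κ
    omega

/-- Keys weakly increase towards the southeast, as ranks on neighbouring diagonals interlace. -/
theorem nodeKey_le_of_mem_aux (h : IsDiagonalSystem n w) {m i m' i' p j p' j' : ℕ}
    (hi' : i' < n m') (hc : (p, p + j) ∈ (nodeDomino n w m i).cells)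
    (hc' : (p', p' + j') ∈ (nodeDomino n w m' i').cells) (hp : p ≤ p') (hq : p + j ≤ p' + j') :
    nodeKey w m i ≤ nodeKey w m' i' := by
  by_contra hlt
  obtain ⟨-, hr⟩ := (mem_nodeDomino_iff h).1 hc
  obtain ⟨hm', hr'⟩ := (mem_nodeDomino_iff h).1 hc'
  have h1 := h.rank_lt_of_station hm' hi' (not_le.1 hlt)
  rcases le_total j j' with hjj | hjj
  · obtain ⟨d, rfl⟩ := Nat.exists_eq_add_of_le hjj
    have h2 := h.rank_add_le (j + 1) d (nodeKey w m i)
    rw [show j + 1 + d = j + d + 1 by omega] at h2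
    omega
  · obtain ⟨d, rfl⟩ := Nat.exists_eq_add_of_le hjj
    have h2 := h.rank_le_add (j' + 1) d (nodeKey w m i)
    rw [show j' + 1 + d = j' + d + 1 by omega] at h2
    omega

/-- Keys weakly increase towards the southeast, also if boxes on `D_{-1}` are involved. -/
theorem nodeKey_le_of_mem (h : IsDiagonalSystem n w) {m i m' i' : ℕ} (hi' : i' < n m')
    {b c : ℕ × ℕ} (hb : b ∈ (nodeDomino n w m i).cells) (hc : c ∈ (nodeDomino n w m' i').cells)
    (h1 : b.1 ≤ c.1) (h2 : b.2 ≤ c.2) : nodeKey w m i ≤ nodeKey w m' i' := by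
  -- a node of station `0` is represented by its box on `D_0` instead of its box on `D_{-1}`
  have hzero : ∀ i, (rank n w 1 (nodeKey w 0 i), rank n w 1 (nodeKey w 0 i) + 0) ∈
      (nodeDomino n w 0 i).cells := fun i => (mem_nodeDomino_iff h).2 ⟨Or.inl rfl, rfl⟩
  rcases cases_of_mem_nodeDomino hb with ⟨p, j, rfl⟩ | ⟨j, rfl⟩ <;>
    rcases cases_of_mem_nodeDomino hc with ⟨p', j', rfl⟩ | ⟨j', rfl⟩
  · exact h.nodeKey_le_of_mem_aux hi' hb hc h1 h2
  · obtain ⟨rfl, hr⟩ := (mem_nodeDomino_neg_iff h).1 hc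
    have h3 : rank n w 0 (nodeKey w 0 i') ≤ rank n w 1 (nodeKey w 0 i') + 1 := h.rank_le_succ 0 _
    simp only at h1 h2
    exact h.nodeKey_le_of_mem_aux hi' hb (hzero i') (by omega) (by omega)
  · obtain ⟨rfl, hr⟩ := (mem_nodeDomino_neg_iff h).1 hb
    have h3 : rank n w 1 (nodeKey w 0 i) ≤ rank n w 0 (nodeKey w 0 i) := h.rank_succ_le 0 _
    simp only at h1 h2
    exact h.nodeKey_le_of_mem_aux hi' (hzero i) hc (by omega) (by omega)
  · obtain ⟨rfl, hr⟩ := (mem_nodeDomino_neg_iff h).1 hb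
    obtain ⟨rfl, hr'⟩ := (mem_nodeDomino_neg_iff h).1 hc
    by_contra hlt
    have := h.rank_lt hi' (not_le.1 hlt)
    simp only at h1
    omega

theorem maxLetter_le_minLetter (h : IsDiagonalSystem n w) {m i i' : ℕ} (hi : i < i')
    (hi' : i' < n m) : (w m i).maxLetter ≤ (w m i').minLetter := by
  have hstep : ∀ i, i + 1 < n m → (w m i).maxLetter ≤ (w m (i + 1)).minLetter := fun i hi =>
    ((h.east m i (by have := h.le_len m; omega)).1.trans
      (SetEntry.minLetter_le_maxLetter _)).trans (h.south m i hi).1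
  induction i', hi using Nat.le_induction with
  | base => exact hstep i hi'
  | succ i' _ ih =>
    exact ((ih (by omega)).trans (SetEntry.minLetter_le_maxLetter _)).trans (hstep i' hi')

theorem eastOK_of_le (h : IsDiagonalSystem n w) {m i i' : ℕ} (hi : i ≤ i') (hi' : i' < n (m + 2)) :
    EastOK (w m i) (w (m + 2) i') := by
  have h1 := h.east m i (hi.trans_lt hi')
  rcases hi.lt_or_eq with hlt | rfl
  · exact h1.trans_le (h.maxLetter_le_minLetter hlt hi')
  · exact h1

theorem southOK_of_lt (h : IsDiagonalSystem n w) {m i i' : ℕ} (hi : i < i') (hi' : i' < n m) :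
    SouthOK (w (m + 2) i) (w m i') := by
  have h1 := h.south m i (lt_of_le_of_lt hi hi')
  rcases (Nat.succ_le_of_lt hi).lt_or_eq with hlt | rfl
  · exact h1.trans_le (h.maxLetter_le_minLetter hlt hi')
  · exact h1

/-! ### The tableau of a diagonal system -/

open Classical in
/-- The filling of the dominoes of the nodes of a diagonal system. -/
noncomputable def fill (n : ℕ → ℕ) (w : ℕ → ℕ → SetEntry) (d : Domino) : Option SetEntry :=
  if h : ∃ ν : ℕ × ℕ, ν.2 < n ν.1 ∧ nodeDomino n w ν.1 ν.2 = d then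
    some (w h.choose.1 h.choose.2) else none

theorem fill_nodeDomino (h : IsDiagonalSystem n w) {m i : ℕ} (hi : i < n m) :
    fill n w (nodeDomino n w m i) = some (w m i) := by
  have hex : ∃ ν : ℕ × ℕ, ν.2 < n ν.1 ∧ nodeDomino n w ν.1 ν.2 = nodeDomino n w m i :=
    ⟨(m, i), hi, rfl⟩
  rw [fill, dif_pos hex]
  obtain ⟨h1, h2⟩ := h.nodeDomino_inj hex.choose_spec.1 hi hex.choose_spec.2
  rw [h1, h2]

theorem exists_of_fill_eq_some {d : Domino} {A : SetEntry} (hd : fill n w d = some A) :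
    ∃ m i, i < n m ∧ d = nodeDomino n w m i ∧ A = w m i := by
  by_cases hex : ∃ ν : ℕ × ℕ, ν.2 < n ν.1 ∧ nodeDomino n w ν.1 ν.2 = d
  · rw [fill, dif_pos hex] at hd
    exact ⟨_, _, hex.choose_spec.1, hex.choose_spec.2.symm, (Option.some.inj hd).symm⟩
  · rw [fill, dif_neg hex] at hd
    exact absurd hd (by simp)

end IsDiagonalSystem

/-- The letter of a smaller key is not larger. -/
theorem letter_le_of_key_le {x y : Letter} {m m' : ℤ} (h : key x m ≤ key y m') : x ≤ y := by
  rcases key_le_key_iff.1 h with h | ⟨h, -⟩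
  exacts [h.le, h.le]

namespace IsDiagonalSystem

variable {n : ℕ → ℕ} {w : ℕ → ℕ → SetEntry}

/-- An unprimed letter occurs once in a column: down a column the key weakly increases, so that the
station cannot decrease, while the content decreases. -/
theorem eq_of_col (h : IsDiagonalSystem n w) {m i m' i' : ℕ} (hi : i < n m) (hi' : i' < n m')
    {b c : ℕ × ℕ} (hb : b ∈ (nodeDomino n w m i).cells) (hc : c ∈ (nodeDomino n w m' i').cells)
    (hbc : b.2 = c.2) (hlt : b.1 < c.1) (hx : (w m i).minLetter = (w m' i').minLetter)
    (hp : ¬ (w m i).minLetter.IsPrimed) : m = m' ∧ i = i' := by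
  have hk := h.nodeKey_le_of_mem hi' hb hc hlt.le hbc.le
  have hm : (m : ℤ) ≤ m' := by
    rcases key_le_key_iff.1 hk with h1 | ⟨-, -, h1⟩
    · exact absurd h1 (by rw [hx]; exact lt_irrefl _)
    · exact h1 hp
  have hb' := Domino.content_of_mem hb
  have hc' := Domino.content_of_mem hc
  rw [station_nodeDomino] at hb' hc'
  simp only [content] at hb' hc'
  obtain rfl : m = m' := by omega
  exact h.nodeKey_inj hi hi' (by rw [nodeKey, nodeKey, hx])

/-- A primed letter occurs once in a row: along a row the key weakly increases, so that the station
cannot increase, while the content increases. -/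
theorem eq_of_row (h : IsDiagonalSystem n w) {m i m' i' : ℕ} (hi : i < n m) (hi' : i' < n m')
    {b c : ℕ × ℕ} (hb : b ∈ (nodeDomino n w m i).cells) (hc : c ∈ (nodeDomino n w m' i').cells)
    (hbc : b.1 = c.1) (hlt : b.2 < c.2) (hx : (w m i).minLetter = (w m' i').minLetter)
    (hp : (w m i).minLetter.IsPrimed) : m = m' ∧ i = i' := by
  have hk := h.nodeKey_le_of_mem hi' hb hc hbc.le hlt.le
  have hm : (m' : ℤ) ≤ m := by
    rcases key_le_key_iff.1 hk with h1 | ⟨-, h1, -⟩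
    · exact absurd h1 (by rw [hx]; exact lt_irrefl _)
    · exact h1 hp
  have hb' := Domino.content_of_mem hb
  have hc' := Domino.content_of_mem hc
  rw [station_nodeDomino] at hb' hc'
  simp only [content] at hb' hc'
  obtain rfl : m = m' := by omega
  exact h.nodeKey_inj hi hi' (by rw [nodeKey, nodeKey, hx])

section Paving

variable {lam : YoungDiagram}

/-- The boxes of the nodes on `D_{-1}` belong to the partition. -/
theorem row_le_diagLen_transpose (hlen0 : diagLen lam 0 = n 0 + n 1)
    (hn0 : n 0 ≤ diagLen lam.transpose 1) (h : IsDiagonalSystem n w) {i : ℕ} (hi : i < n 0) :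
    rank n w 0 (nodeKey w 0 i) ≤ diagLen lam.transpose 1 := by
  have h1 := h.countLT_nodeKey hi
  have h2 := countLT_le (n := n) (w := w) 1 (nodeKey w 0 i)
  have h3 := diagLen_le_succ lam.transpose 0
  have h4 : diagLen lam.transpose 0 = diagLen lam 0 := by
    rw [← card_content_neg_eq_diagLen, ← card_content_eq_diagLen]; simp
  simp only [rank, zero_add] at h3 ⊢
  omega

theorem cells_subset (h : IsDiagonalSystem n w) (hlen : ∀ j, diagLen lam j = n j + n (j + 1))
    (hn0 : n 0 ≤ diagLen lam.transpose 1) {m i : ℕ} (hi : i < n m) {c : ℕ × ℕ}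
    (hc : c ∈ (nodeDomino n w m i).cells) : c ∈ lam := by
  rcases cases_of_mem_nodeDomino hc with ⟨p, j, rfl⟩ | ⟨j, rfl⟩
  · obtain ⟨hm, hr⟩ := (mem_nodeDomino_iff h).1 hc
    rw [← lt_diagLen_iff, hlen, ← hr]
    exact h.rank_lt_len hm hi
  · obtain ⟨rfl, hr⟩ := (mem_nodeDomino_neg_iff h).1 hc
    have := h.row_le_diagLen_transpose (hlen 0) hn0 hi
    exact lt_diagLen_transpose_iff.1 (by omega)

/-- The dominoes of the nodes of a diagonal system, whose lengths are those of a given paving,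
extend to a paving by dominoes strictly below `D_0`. -/
theorem exists_paving (h : IsDiagonalSystem n w) {P₀ : Finset Domino} (hP₀ : IsPaving lam P₀)
    (hn : ∀ m, n m = stationCount P₀ m) :
    ∃ P, IsPaving lam P ∧
      ∀ d, 0 ≤ d.station → (d ∈ P ↔ ∃ m i, i < n m ∧ nodeDomino n w m i = d) := by
  classical
  have hlen : ∀ j, diagLen lam j = n j + n (j + 1) := fun j => by
    rw [hn, hn, hP₀.diagLen_eq]; push_cast; rfl
  have hlow := hP₀.diagLen_transpose_eq 1
  have hn0 : n 0 ≤ diagLen lam.transpose 1 := by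
    rw [hlow, hn]; simp
  let r : ℕ → ℕ := fun i => rank n w 0 (nodeKey w 0 i)
  have hrpos : ∀ i, 1 ≤ r i := fun i => by simp only [r, rank]; omega
  have hrinj : ∀ i < n 0, ∀ i' < n 0, r i = r i' → i = i' := by
    intro i hi i' hi' he
    by_contra hne
    rcases Nat.lt_or_gt_of_ne hne with hlt | hlt
    · exact (h.rank_lt hi (h.nodeKey_lt hlt hi')).ne he
    · exact (h.rank_lt hi' (h.nodeKey_lt hlt hi)).ne' he
  have hrlen : ∀ i < n 0, r i ≤ diagLen lam.transpose 1 := fun i hi =>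
    h.row_le_diagLen_transpose (hlen 0) hn0 hi
  -- the boxes of the nodes on `D_{-1}`
  let Z : Finset ℕ := (Finset.range (n 0)).image fun i => r i - 1
  have hZ : ∀ j, j ∈ Z ↔ ∃ i < n 0, r i = j + 1 := by
    intro j
    simp only [Z, Finset.mem_image, Finset.mem_range]
    constructor
    · rintro ⟨i, hi, rfl⟩
      exact ⟨i, hi, by have := hrpos i; omega⟩
    · rintro ⟨i, hi, he⟩
      exact ⟨i, hi, by omega⟩
  obtain ⟨Q, hQ1, hQ2⟩ := hP₀.exists_paving_below 1 Z
    (fun j hj => by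
      obtain ⟨i, hi, he⟩ := (hZ j).1 hj
      have := hrlen i hi
      exact Finset.mem_range.2 (by omega))
    (by
      rw [Finset.card_image_of_injOn, Finset.card_range, hn]
      · simp
      · intro i hi i' hi' he
        have := hrpos i
        have := hrpos i'
        simp only at he
        exact hrinj i (Finset.mem_range.1 hi) i' (Finset.mem_range.1 hi') (by omega))
  have hM : ∀ m, lam.rowLen 0 ≤ m → n m = 0 := by
    intro m hm
    by_contra hne
    have : 0 < diagLen lam m := by rw [hlen]; omega
    rw [lt_diagLen_iff, YoungDiagram.mem_iff_lt_rowLen] at this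
    omega
  let N : Finset Domino := ((Finset.range (lam.rowLen 0)).sigma fun m => Finset.range (n m)).image
    fun ν => nodeDomino n w ν.1 ν.2
  have hN : ∀ d, d ∈ N ↔ ∃ m i, i < n m ∧ nodeDomino n w m i = d := by
    intro d
    simp only [N, Finset.mem_image, Finset.mem_sigma, Finset.mem_range]
    constructor
    · rintro ⟨ν, ⟨-, hi⟩, he⟩
      exact ⟨ν.1, ν.2, hi, he⟩
    · rintro ⟨m, i, hi, he⟩
      refine ⟨⟨m, i⟩, ⟨?_, hi⟩, he⟩
      by_contra hm
      rw [hM m (not_lt.1 hm)] at hi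
      omega
  have hQst : ∀ d ∈ Q, d.station ≤ -1 := fun d hd => by
    have := (hQ1 d hd).1
    push_cast at this
    exact this
  have hQcontent : ∀ d ∈ Q, ∀ c ∈ d.cells, content c < 0 := fun d hd c hc => by
    have h1 := hQst d hd
    have h2 := Domino.content_of_mem hc
    omega
  refine ⟨N ∪ Q, ⟨fun d hd c hc => ?_, ?_⟩, fun d hd => ?_⟩
  · rcases Finset.mem_union.1 hd with hd | hd
    · obtain ⟨m, i, hi, rfl⟩ := (hN d).1 hd
      exact h.cells_subset hlen hn0 hi hc
    · exact (hQ1 d hd).2.1 hc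
  · rintro ⟨a, b⟩ hc
    rcases le_or_gt a b with hab | hab
    · obtain ⟨j, rfl⟩ := Nat.exists_eq_add_of_le hab
      have hl : a < n j + n (j + 1) := hlen j ▸ lt_diagLen_iff.2 hc
      obtain ⟨m, i, hm, hi, hr⟩ := h.exists_rank_eq hl
      refine ⟨nodeDomino n w m i, ⟨Finset.mem_union_left _ ((hN _).2 ⟨m, i, hi, rfl⟩),
        (mem_nodeDomino_iff h).2 ⟨hm, hr⟩⟩, ?_⟩
      rintro d ⟨hd, hcd⟩
      rcases Finset.mem_union.1 hd with hd | hd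
      · obtain ⟨m', i', hi', rfl⟩ := (hN d).1 hd
        obtain ⟨hm', hr'⟩ := (mem_nodeDomino_iff h).1 hcd
        obtain ⟨rfl, rfl⟩ := h.rank_inj hm hi hm' hi' (hr.trans hr'.symm)
        rfl
      · have := hQcontent d hd _ hcd
        simp only [content] at this
        omega
    by_cases hbZ : a = b + 1 ∧ b ∈ Z
    · obtain ⟨rfl, hbZ⟩ := hbZ
      obtain ⟨i, hi, hr⟩ := (hZ b).1 hbZ
      refine ⟨nodeDomino n w 0 i, ⟨Finset.mem_union_left _ ((hN _).2 ⟨0, i, hi, rfl⟩),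
        (mem_nodeDomino_neg_iff h).2 ⟨rfl, hr⟩⟩, ?_⟩
      rintro d ⟨hd, hcd⟩
      rcases Finset.mem_union.1 hd with hd | hd
      · obtain ⟨m', i', hi', rfl⟩ := (hN d).1 hd
        obtain ⟨rfl, hr'⟩ := (mem_nodeDomino_neg_iff h).1 hcd
        rw [hrinj i hi i' hi' (hr.trans hr'.symm)]
      · exact absurd hcd ((hQ1 d hd).2.2 b hbZ)
    · obtain ⟨d, ⟨hd, hcd⟩, huniq⟩ := hQ2 (a, b) hc (by simp only [content]; push_cast; omega)
        (fun j hj he => hbZ (by obtain ⟨rfl, rfl⟩ := Prod.mk.inj he; exact ⟨rfl, hj⟩))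
      refine ⟨d, ⟨Finset.mem_union_right _ hd, hcd⟩, ?_⟩
      rintro e ⟨he, hce⟩
      rcases Finset.mem_union.1 he with he | he
      · exfalso
        obtain ⟨m', i', hi', rfl⟩ := (hN e).1 he
        rcases cases_of_mem_nodeDomino hce with ⟨p, j, hpj⟩ | ⟨j, hj⟩
        · obtain ⟨rfl, rfl⟩ := Prod.mk.inj hpj
          omega
        · obtain ⟨rfl, rfl⟩ := Prod.mk.inj hj
          obtain ⟨rfl, hr'⟩ := (mem_nodeDomino_neg_iff h).1 hce
          exact hbZ ⟨rfl, (hZ _).2 ⟨i', hi', hr'⟩⟩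
      · exact huniq e ⟨he, hce⟩
  · rw [Finset.mem_union, hN]
    refine ⟨fun hd' => hd'.resolve_right fun hq => ?_, Or.inl⟩
    have := hQst d hq
    omega

/-- In a paving that extends the dominoes of the nodes, a vertical domino on `D_0` with left
neighbours has one that lies on `D_0`. -/
theorem no_bad_vertical (h : IsDiagonalSystem n w) {P : Finset Domino} (hP : IsPaving lam P)
    (hPn : ∀ d, 0 ≤ d.station → (d ∈ P ↔ ∃ m i, i < n m ∧ nodeDomino n w m i = d)) :
    ¬ ∃ d ∈ P, d.IsVertical ∧ d.diagonal = 0 ∧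
      (∃ e ∈ P, LeftAdjacent e d) ∧ ∀ e ∈ P, LeftAdjacent e d → e.diagonal < 0 := by
  rintro ⟨d, hd, hv, hd0, ⟨e, he, hed⟩, hall⟩
  rw [Domino.diagonal_eq] at hd0
  obtain ⟨m, i, hi, rfl⟩ := (hPn d (by omega)).1 hd
  rw [station_nodeDomino] at hd0
  have hhi := hi_nodeDomino (n := n) (w := w) m i
  have hlo := h.lo_nodeDomino m i
  have hv' := Domino.isVertical_iff.1 hv
  obtain rfl | rfl : m = 1 ∨ m = 0 := by omega
  · set p := rank n w (1 + 1) (nodeKey w 1 i) with hp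
    have hc : (p, p) ∈ lam := lam.up_left_mem le_rfl (Nat.le_succ p) (hhi ▸ hP.hi_mem hd)
    obtain ⟨f, ⟨hf, hfc⟩, -⟩ := hP.2 _ hc
    have h1 := hall f hf ⟨(p, p), hfc, (p, p + 1), hhi ▸ Domino.hi_mem _, rfl, rfl⟩
    rw [Domino.diagonal_neg_iff] at h1
    have h2 := Domino.content_of_mem hfc
    simp only [content] at h2
    omega
  · rw [hlo, hhi] at hv'
    have h1 := h.countLT_nodeKey hi
    have hc1 : countLT n w 1 (nodeKey w 0 i) = 0 := by
      simp only [rank, zero_add] at hv'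
      omega
    have hrank : rank n w (0 + 1) (nodeKey w 0 i) = i := by
      simp only [rank, zero_add]
      omega
    rw [hrank] at hhi hv'
    simp only at hv'
    cases i with
    | zero =>
      obtain ⟨c, -, b, hb, -, h2⟩ := hed
      have hb2 : b.2 = 0 := by
        rcases Domino.mem_cells.1 hb with rfl | rfl
        · rw [hhi]
        · rw [hlo, hv']
      omega
    | succ i =>
      have hi' : i < n 0 := by omega
      have h2 := h.countLT_nodeKey hi'
      have h3 := (countLT_mono (n := n) (w := w) 1 (h.nodeKey_lt (Nat.lt_succ_self i) hi).le).trans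
        hc1.le
      have hmem : (i + 1, i) ∈ (nodeDomino n w 0 i).cells :=
        (mem_nodeDomino_neg_iff h).2 ⟨rfl, by simp only [rank]; omega⟩
      have hst : (nodeDomino n w 0 i).station = 0 := station_nodeDomino 0 i
      have h4 := hall (nodeDomino n w 0 i) ((hPn _ hst.ge).2 ⟨0, i, hi', rfl⟩)
        ⟨(i + 1, i), hmem, (i + 1, i + 1), hhi ▸ Domino.hi_mem _, rfl, rfl⟩
      rw [Domino.diagonal_neg_iff, hst] at h4
      exact lt_irrefl _ h4

/-- Every diagonal system whose lengths are those of a shifted paving of `lam` belongs to a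
shifted set-valued domino tableau of shape `lam`. -/
theorem exists_tableau (h : IsDiagonalSystem n w) {P₀ : Finset Domino}
    (hP₀ : IsShiftedPaving lam P₀) (hn : ∀ m, n m = stationCount P₀ m) :
    ∃ T : ShiftedSetDominoTableau lam, T.up = systemUp n w := by
  classical
  obtain ⟨P, hP, hPn⟩ := h.exists_paving hP₀.paving hn
  have hst : ∀ m i, 0 ≤ (nodeDomino n w m i).station := fun m i => by
    rw [station_nodeDomino]; positivity
  have hmap : ∀ {d : Domino} {x : Letter}, (fill n w d).map SetEntry.minLetter = some x →
      ∃ m i, i < n m ∧ d = nodeDomino n w m i ∧ x = (w m i).minLetter := by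
    intro d x hx
    obtain ⟨A, hA, rfl⟩ := Option.map_eq_some_iff.1 hx
    obtain ⟨m, i, hi, hd, rfl⟩ := exists_of_fill_eq_some hA
    exact ⟨m, i, hi, hd, rfl⟩
  have hstation : ∀ {m i m' i' : ℕ}, (nodeDomino n w m i).type = (nodeDomino n w m' i').type →
      (nodeDomino n w m' i').diagonal = (nodeDomino n w m i).diagonal + 1 → m' = m + 2 := by
    intro m i m' i' ht hd
    rw [Domino.diagonal_eq, Domino.diagonal_eq, station_nodeDomino, station_nodeDomino] at hd
    rw [Domino.type_eq, Domino.type_eq, station_nodeDomino, station_nodeDomino] at ht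
    split_ifs at ht <;> omega
  refine ⟨⟨P, ⟨hP, hP₀.last_fst, hP₀.last_snd, h.no_bad_vertical hP hPn⟩, fill n w,
    ⟨?_, ?_, ?_, ?_, ?_⟩, ?_, ?_⟩, ?_⟩
  · intro d
    rw [Option.isSome_map, Domino.diagonal_nonneg_iff]
    constructor
    · intro hs
      obtain ⟨A, hA⟩ := Option.isSome_iff_exists.1 hs
      obtain ⟨m, i, hi, rfl, -⟩ := exists_of_fill_eq_some hA
      exact ⟨(hPn _ (hst m i)).2 ⟨m, i, hi, rfl⟩, hst m i⟩
    · rintro ⟨hd, hs⟩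
      obtain ⟨m, i, hi, rfl⟩ := (hPn d hs).1 hd
      rw [h.fill_nodeDomino hi]
      rfl
  · rintro d e x y hx hy ⟨b, hb, c, hc, h1, h2⟩
    obtain ⟨m, i, hi, rfl, rfl⟩ := hmap hx
    obtain ⟨m', i', hi', rfl, rfl⟩ := hmap hy
    exact letter_le_of_key_le (h.nodeKey_le_of_mem hi' hb hc h1.le h2.le)
  · rintro d e x y hx hy ⟨b, hb, c, hc, h1, h2⟩
    obtain ⟨m, i, hi, rfl, rfl⟩ := hmap hx
    obtain ⟨m', i', hi', rfl, rfl⟩ := hmap hy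
    exact letter_le_of_key_le (h.nodeKey_le_of_mem hi' hb hc h2.le h1.le)
  · rintro d e x hx hy hp ⟨b, hb, c, hc, h1⟩
    obtain ⟨m, i, hi, rfl, hxm⟩ := hmap hx
    obtain ⟨m', i', hi', rfl, hxm'⟩ := hmap hy
    rcases lt_trichotomy b.1 c.1 with hlt | heq | hlt
    · obtain ⟨rfl, rfl⟩ := h.eq_of_col hi hi' hb hc h1 hlt (hxm ▸ hxm') (hxm ▸ hp)
      rfl
    · exact hP.eq_of_mem ((hPn _ (hst _ _)).2 ⟨m, i, hi, rfl⟩)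
        ((hPn _ (hst _ _)).2 ⟨m', i', hi', rfl⟩) hb (Prod.ext heq h1 ▸ hc)
    · obtain ⟨rfl, rfl⟩ := h.eq_of_col hi' hi hc hb h1.symm hlt (hxm' ▸ hxm) (hxm' ▸ hp)
      rfl
  · rintro d e x hx hy hp ⟨b, hb, c, hc, h1⟩
    obtain ⟨m, i, hi, rfl, hxm⟩ := hmap hx
    obtain ⟨m', i', hi', rfl, hxm'⟩ := hmap hy
    rcases lt_trichotomy b.2 c.2 with hlt | heq | hlt
    · obtain ⟨rfl, rfl⟩ := h.eq_of_row hi hi' hb hc h1 hlt (hxm ▸ hxm') (hxm ▸ hp)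
      rfl
    · exact hP.eq_of_mem ((hPn _ (hst _ _)).2 ⟨m, i, hi, rfl⟩)
        ((hPn _ (hst _ _)).2 ⟨m', i', hi', rfl⟩) hb (Prod.ext h1 heq ▸ hc)
    · obtain ⟨rfl, rfl⟩ := h.eq_of_row hi' hi hc hb h1.symm hlt (hxm' ▸ hxm) (hxm' ▸ hp)
      rfl
  · rintro F₁ F₂ A B hA hB ht ⟨c, hc, h1, h2⟩ hd
    obtain ⟨m, i, hi, rfl, rfl⟩ := exists_of_fill_eq_some hA
    obtain ⟨m', i', hi', rfl, rfl⟩ := exists_of_fill_eq_some hB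
    obtain rfl := hstation ht hd
    have hk := h.nodeKey_le_of_mem hi' (Domino.topLeft_mem _) hc h1 h2
    refine h.eastOK_of_le (not_lt.1 fun hlt => ?_) hi'
    have h3 := h.nodeKey_south (m := m) (i := i') (by omega)
    have h4 : nodeKey w m (i' + 1) ≤ nodeKey w m i := by
      rcases (Nat.succ_le_of_lt hlt).lt_or_eq with h5 | h5
      · exact (h.nodeKey_lt h5 hi).le
      · exact (congrArg _ h5).le
    exact absurd (h3.trans_le (h4.trans hk)) (lt_irrefl _)
  · rintro F₁ F₂ A B hA hB ht ⟨c, hc, h1, h2⟩ hd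
    obtain ⟨m, i, hi, rfl, rfl⟩ := exists_of_fill_eq_some hA
    obtain ⟨m', i', hi', rfl, rfl⟩ := exists_of_fill_eq_some hB
    obtain rfl := hstation ht.symm hd
    have hk := h.nodeKey_le_of_mem hi' (Domino.topLeft_mem _) hc h1 h2
    refine h.southOK_of_lt (not_le.1 fun hle => ?_) hi'
    have h3 := h.nodeKey_east hi
    have h4 : nodeKey w m' i' ≤ nodeKey w m' i := by
      rcases hle.lt_or_eq with h5 | h5
      · exact (h.nodeKey_lt h5 (hi.trans_le (h.len_le m'))).le
      · exact (congrArg _ h5).le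
    exact absurd ((hk.trans h4).trans_lt h3) (lt_irrefl _)
  · ext p
    constructor
    · rintro ⟨-, -, hf⟩
      obtain ⟨m, i, hi, hd, hA⟩ := exists_of_fill_eq_some hf
      exact ⟨m, i, hi, Prod.ext hd hA⟩
    · rintro ⟨m, i, hi, rfl⟩
      exact ⟨(hPn _ (hst m i)).2 ⟨m, i, hi, rfl⟩, Domino.diagonal_nonneg_iff.2 (hst m i),
        h.fill_nodeDomino hi⟩

end Paving

end IsDiagonalSystem

/-! ### Diagonals of the 2-quotient -/

/-- The number of rows of a list of row lengths that meet the diagonal `D_k`. -/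
def diagCount : List ℕ → ℕ → ℕ
  | [], _ => 0
  | a :: l, k => (if k < a then 1 else 0) + diagCount l (k + 1)

theorem diagCount_eq_card (l : List ℕ) (k : ℕ) :
    diagCount l k = ((Finset.range l.length).filter fun i => i + k < l.getD i 0).card := by
  induction l generalizing k with
  | nil => simp [diagCount]
  | cons a l ih =>
    rw [diagCount, ih, Finset.card_filter, Finset.card_filter, List.length_cons,
      Finset.sum_range_succ', add_comm]
    simp only [List.getD_cons_succ, List.getD_cons_zero, zero_add, add_right_comm, add_assoc]

theorem diagCount_rowLens (μ : YoungDiagram) (k : ℕ) : diagCount μ.rowLens k = diagLen μ k := by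
  rw [diagCount_eq_card, diagLen, YoungDiagram.length_rowLens]
  congr 1
  refine Finset.filter_congr fun i hi => ?_
  rw [Finset.mem_range] at hi
  rw [List.getD_eq_getElem _ _ (by rwa [YoungDiagram.length_rowLens]), YoungDiagram.get_rowLens,
    YoungDiagram.mem_iff_lt_rowLen]

theorem betaNumbers_cons (a : ℕ) (l : List ℕ) :
    betaNumbers (a :: l) = (a + l.length) :: betaNumbers l := by
  simp only [betaNumbers, List.mapIdx_cons, List.length_cons]
  congr 1
  congr 1
  funext i x
  omega

theorem length_betaNumbers (l : List ℕ) : (betaNumbers l).length = l.length := by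
  simp [betaNumbers]

theorem lt_of_mem_betaNumbers {l : List ℕ} {a x : ℕ} (hl : ∀ y ∈ l, y ≤ a)
    (hx : x ∈ betaNumbers l) : x < a + l.length := by
  induction l with
  | nil => simp [betaNumbers] at hx
  | cons b l ih =>
    rw [betaNumbers_cons, List.mem_cons] at hx
    rw [List.length_cons]
    rcases hx with rfl | hx
    · have := hl b (by simp); omega
    · have := ih (fun y hy => hl y (by simp [hy])) hx; omega

theorem pairwise_betaNumbers {l : List ℕ} (hl : l.Pairwise (· ≥ ·)) :
    (betaNumbers l).Pairwise (· > ·) := by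
  induction l with
  | nil => simp [betaNumbers]
  | cons a l ih =>
    rw [List.pairwise_cons] at hl
    rw [betaNumbers_cons, List.pairwise_cons]
    exact ⟨fun x hx => lt_of_mem_betaNumbers hl.1 hx, ih hl.2⟩

theorem diagCount_eq_countP (l : List ℕ) (k : ℕ) :
    diagCount l k = (betaNumbers l).countP fun x => k + l.length ≤ x := by
  induction l generalizing k with
  | nil => simp [diagCount, betaNumbers]
  | cons a l ih =>
    rw [diagCount, ih, betaNumbers_cons, List.countP_cons, List.length_cons, add_comm]
    congr 1
    · congr 1
      funext x
      rw [show k + 1 + l.length = k + (l.length + 1) by omega]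
    · simp only [decide_eq_true_eq]
      congr 1
      rw [eq_iff_iff]
      omega

/-- Subtracting `r, r + 2, …` from right to left and halving, before zeros are deleted. -/
theorem mapIdx_cons_quotient (r x : ℕ) (E : List ℕ) :
    ((x :: E).mapIdx fun i y => (y - (2 * ((x :: E).length - 1 - i) + r)) / 2) =
      (x - (2 * E.length + r)) / 2 ::
        E.mapIdx fun i y => (y - (2 * (E.length - 1 - i) + r)) / 2 := by
  simp only [List.mapIdx_cons, List.length_cons]
  congr 1
  congr 1
  funext i y
  rw [show E.length + 1 - 1 - (i + 1) = E.length - 1 - i by omega]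

/-- The number of rows of a component of the 2-quotient that meet `D_k` is the number of beta
numbers in its residue class above a bound that does not depend on the row. -/
theorem diagCount_quotient (r : ℕ) (E : List ℕ) (hE : E.Pairwise (· > ·))
    (hr : ∀ x ∈ E, x % 2 = r) (k : ℕ) :
    diagCount ((E.mapIdx fun i y => (y - (2 * (E.length - 1 - i) + r)) / 2).filter
      fun x => 0 < x) k = E.countP fun x => 2 * (k + E.length) + r ≤ x := by
  induction E generalizing k with
  | nil => simp [diagCount]
  | cons x E ih =>
    rw [List.pairwise_cons] at hE
    have ih' := ih hE.2 (fun y hy => hr y (by simp [hy]))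
    have hx := hr x (by simp)
    rw [mapIdx_cons_quotient, List.filter_cons, List.countP_cons, List.length_cons]
    simp only [decide_eq_true_eq]
    by_cases hpos : 0 < (x - (2 * E.length + r)) / 2
    · rw [if_pos hpos, diagCount, ih', add_comm]
      congr 1
      · congr 1
        funext y
        rw [show k + 1 + E.length = k + (E.length + 1) by omega]
      · congr 1
        rw [eq_iff_iff]
        omega
    · -- all later elements are smaller than `x`, so that nothing is counted on either side
      rw [if_neg hpos, ih', if_neg (by omega), List.countP_eq_zero.2, List.countP_eq_zero.2]
      · intro y hy
        have := hE.1 y hy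
        have := hr y (by simp [hy])
        simp only [decide_eq_true_eq]
        omega
      · intro y hy
        have := hE.1 y hy
        have := hr y (by simp [hy])
        simp only [decide_eq_true_eq]
        omega

/-! ### Balance of even and odd beta numbers -/

/-- The sum of `(-1)^(i+j)` over the boxes `(i, j)` of the diagram with the given row lengths. -/
def signSum : List ℕ → ℤ
  | [] => 0
  | a :: l => (a % 2 : ℕ) - signSum l

theorem signSum_eq_sum (l : List ℕ) :
    signSum l = ∑ i ∈ Finset.range l.length, (-1) ^ i * ((l.getD i 0 % 2 : ℕ) : ℤ) := by
  induction l with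
  | nil => simp [signSum]
  | cons a l ih =>
    rw [signSum, ih, List.length_cons, Finset.sum_range_succ']
    simp only [List.getD_cons_succ, List.getD_cons_zero, pow_succ, pow_zero, one_mul]
    rw [sub_eq_add_neg, add_comm, ← Finset.sum_neg_distrib]
    congr 1
    exact Finset.sum_congr rfl fun i _ => by ring

theorem sum_neg_one_pow_range (a : ℕ) : ∑ j ∈ Finset.range a, (-1 : ℤ) ^ j = (a % 2 : ℕ) := by
  induction a with
  | zero => simp
  | succ a ih =>
    rw [Finset.sum_range_succ, ih]
    rcases Nat.even_or_odd a with h | h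
    · rw [h.neg_one_pow, Nat.even_iff.1 h, Nat.odd_iff.1 h.add_one]; rfl
    · rw [h.neg_one_pow, Nat.odd_iff.1 h, Nat.even_iff.1 h.add_one]; rfl

theorem sum_cells_eq_signSum (lam : YoungDiagram) :
    ∑ c ∈ lam.cells, (-1 : ℤ) ^ (c.1 + c.2) = signSum lam.rowLens := by
  have hcells : lam.cells = ((Finset.range (lam.colLen 0)).sigma fun i =>
      Finset.range (lam.rowLen i)).image fun ν => (ν.1, ν.2) := by
    ext ⟨i, j⟩
    rw [YoungDiagram.mem_cells]
    simp only [Finset.mem_image, Finset.mem_sigma, Finset.mem_range, Prod.mk.injEq]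
    constructor
    · intro h
      exact ⟨⟨i, j⟩, ⟨YoungDiagram.mem_iff_lt_colLen.1
        (lam.up_left_mem le_rfl (Nat.zero_le _) h), YoungDiagram.mem_iff_lt_rowLen.1 h⟩, rfl, rfl⟩
    · rintro ⟨ν, ⟨-, h⟩, rfl, rfl⟩
      exact YoungDiagram.mem_iff_lt_rowLen.2 h
  rw [hcells, Finset.sum_image, Finset.sum_sigma, signSum_eq_sum, YoungDiagram.length_rowLens]
  · refine Finset.sum_congr rfl fun i hi => ?_
    rw [Finset.mem_range] at hi
    rw [List.getD_eq_getElem _ _ (by rwa [YoungDiagram.length_rowLens]),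
      YoungDiagram.get_rowLens, ← sum_neg_one_pow_range, Finset.mul_sum]
    exact Finset.sum_congr rfl fun j _ => pow_add _ _ _
  · rintro ⟨i, j⟩ _ ⟨i', j'⟩ _ h
    obtain ⟨h1, h2⟩ := Prod.mk.inj h
    simp only at h1 h2
    subst h1; subst h2; rfl

/-- Both boxes of a domino have opposite signs. -/
theorem IsPaving.signSum_eq_zero {lam : YoungDiagram} {P : Finset Domino} (hP : IsPaving lam P) :
    signSum lam.rowLens = 0 := by
  classical
  have hcells : lam.cells = P.biUnion Domino.cells := by
    ext c
    rw [Finset.mem_biUnion]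
    constructor
    · intro hc
      obtain ⟨d, ⟨hd, hcd⟩, -⟩ := hP.2 c hc
      exact ⟨d, hd, hcd⟩
    · rintro ⟨d, hd, hcd⟩
      exact hP.1 d hd hcd
  rw [← sum_cells_eq_signSum, hcells, Finset.sum_biUnion]
  · refine Finset.sum_eq_zero fun d _ => ?_
    cases d with
    | horiz i j =>
      rw [Domino.cells, Finset.sum_pair (by simp [Domino.topLeft, Domino.bottomRight])]
      simp only [Domino.topLeft, Domino.bottomRight, pow_add]
      ring
    | vert i j =>
      rw [Domino.cells, Finset.sum_pair (by simp [Domino.topLeft, Domino.bottomRight])]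
      simp only [Domino.topLeft, Domino.bottomRight, pow_add]
      ring
  · intro d hd e he hne
    rw [Function.onFun, Finset.disjoint_left]
    exact fun c hcd hce => hne (hP.eq_of_mem hd he hcd hce)

theorem countP_betaNumbers_sub (l : List ℕ) :
    ((betaNumbers l).countP (fun x => x % 2 = 0) : ℤ) -
        (betaNumbers l).countP (fun x => x % 2 = 1) =
      (l.length % 2 : ℕ) + 2 * (-1) ^ l.length * signSum l := by
  induction l with
  | nil => simp [betaNumbers, signSum]
  | cons a l ih =>
    rw [betaNumbers_cons, List.countP_cons, List.countP_cons, List.length_cons, signSum]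
    simp only [decide_eq_true_eq]
    rcases Nat.mod_two_eq_zero_or_one a with ha | ha <;>
      rcases Nat.mod_two_eq_zero_or_one l.length with hl | hl
    · rw [(Nat.even_iff.2 hl).neg_one_pow, hl] at ih
      rw [pow_succ, (Nat.even_iff.2 hl).neg_one_pow, ha, if_pos (by omega), if_neg (by omega),
        show (l.length + 1) % 2 = 1 by omega]
      push_cast at ih ⊢
      linarith
    · rw [(Nat.odd_iff.2 hl).neg_one_pow, hl] at ih
      rw [pow_succ, (Nat.odd_iff.2 hl).neg_one_pow, ha, if_neg (by omega), if_pos (by omega),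
        show (l.length + 1) % 2 = 0 by omega]
      push_cast at ih ⊢
      linarith
    · rw [(Nat.even_iff.2 hl).neg_one_pow, hl] at ih
      rw [pow_succ, (Nat.even_iff.2 hl).neg_one_pow, ha, if_neg (by omega), if_pos (by omega),
        show (l.length + 1) % 2 = 1 by omega]
      push_cast at ih ⊢
      linarith
    · rw [(Nat.odd_iff.2 hl).neg_one_pow, hl] at ih
      rw [pow_succ, (Nat.odd_iff.2 hl).neg_one_pow, ha, if_pos (by omega), if_neg (by omega),
        show (l.length + 1) % 2 = 0 by omega]
      push_cast at ih ⊢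
      linarith

theorem countP_parity_add (l : List ℕ) :
    l.countP (fun x => x % 2 = 0) + l.countP (fun x => x % 2 = 1) = l.length := by
  rw [List.length_eq_countP_add_countP (fun x => x % 2 = 0)]
  congr 1
  refine List.countP_congr fun x _ => ?_
  simp

/-! ### Lengths of the stations of a paving -/

/-- The number of beta numbers that are at least `m` plus the number of parts and congruent to this
bound modulo `2`. -/
def betaCount (l : List ℕ) (m : ℕ) : ℕ :=
  (betaNumbers l).countP fun x => m + l.length ≤ x ∧ x % 2 = (m + l.length) % 2

theorem betaCount_add_succ (l : List ℕ) (m : ℕ) :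
    betaCount l m + betaCount l (m + 1) = diagCount l m := by
  rw [diagCount_eq_countP, betaCount, betaCount]
  generalize betaNumbers l = b
  induction b with
  | nil => simp
  | cons x b ih =>
    rw [List.countP_cons, List.countP_cons, List.countP_cons, ← ih]
    simp only [decide_eq_true_eq]
    split_ifs <;> omega

/-- The numbers of dominoes of the stations `m ≥ 0` do not depend on the paving. -/
theorem IsPaving.stationCount_eq {lam : YoungDiagram} {P : Finset Domino} (hP : IsPaving lam P)
    (m : ℕ) : stationCount P m = betaCount lam.rowLens m := by
  have hsum : ∀ m, betaCount lam.rowLens m + betaCount lam.rowLens (m + 1) =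
      stationCount P m + stationCount P (m + 1) := fun m => by
    rw [betaCount_add_succ, diagCount_rowLens, hP.diagLen_eq]
  obtain ⟨k, hk⟩ : ∃ k, lam.rowLen 0 ≤ m + k := ⟨_, Nat.le_add_left _ _⟩
  induction k generalizing m with
  | zero =>
    have h0 : diagLen lam m = 0 := by
      by_contra hne
      have := lt_diagLen_iff.1 (Nat.pos_of_ne_zero hne)
      rw [YoungDiagram.mem_iff_lt_rowLen] at this
      omega
    have h1 := hP.diagLen_eq m
    have h2 := hsum m
    omega
  | succ k ih =>
    have h1 := ih (m + 1) (by omega)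
    have h2 := hsum m
    push_cast at h1
    omega

/-- The diagonals of a component of the 2-quotient are as long as the stations of one parity. -/
theorem IsPaving.diagLen_quotient {lam μ : YoungDiagram} {P : Finset Domino} (hP : IsPaving lam P)
    {r s : ℕ} (hμ : μ.rowLens = quotientPart r lam.rowLens)
    (hr : r = 0 ∧ s = lam.rowLens.length % 2 ∨ r = 1 ∧ s = 1 - lam.rowLens.length % 2) (k : ℕ) :
    diagLen μ k = stationCount P (2 * k + s : ℕ) := by
  have hbeta := pairwise_betaNumbers lam.rowLens_sorted.pairwise
  have hlen : 2 * ((betaNumbers lam.rowLens).filter fun x => x % 2 = r).length + r =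
      s + lam.rowLens.length := by
    have h1 := countP_betaNumbers_sub lam.rowLens
    have h2 := countP_parity_add (betaNumbers lam.rowLens)
    rw [hP.signSum_eq_zero, mul_zero, add_zero] at h1
    rw [length_betaNumbers] at h2
    rw [← List.countP_eq_length_filter]
    rcases hr with ⟨rfl, rfl⟩ | ⟨rfl, rfl⟩ <;> omega
  rw [hP.stationCount_eq, ← diagCount_rowLens, hμ, quotientPart, diagCount_quotient,
    List.countP_filter, betaCount]
  · refine List.countP_congr fun x _ => ?_
    simp only [Bool.and_eq_true, decide_eq_true_eq]
    omega
  · exact hbeta.sublist List.filter_sublist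
  · intro x hx
    simpa using (List.mem_filter.1 hx).2

/-! ### Diagonal systems, pairs of tableaux and diagonal words -/

theorem nodeDomino_congr {n : ℕ → ℕ} {w w' : ℕ → ℕ → SetEntry}
    (h : ∀ m i, i < n m → w m i = w' m i) {m i : ℕ} (hi : i < n m) :
    nodeDomino n w m i = nodeDomino n w' m i := by
  have hkey : ∀ {m i}, i < n m → nodeKey w m i = nodeKey w' m i := fun hi => by
    rw [nodeKey, nodeKey, h _ _ hi]
  have hcount : ∀ m κ, countLT n w m κ = countLT n w' m κ := fun m κ => by
    rw [countLT, countLT]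
    congr 1
    exact Finset.filter_congr fun i hi => by rw [hkey (Finset.mem_range.1 hi)]
  have hrank : ∀ m κ, rank n w m κ = rank n w' m κ := fun m κ => by
    cases m <;> simp only [rank, hcount]
  simp only [nodeDomino, hkey hi, hrank]

theorem systemUp_congr {n : ℕ → ℕ} {w w' : ℕ → ℕ → SetEntry}
    (h : ∀ m i, i < n m → w m i = w' m i) : systemUp n w = systemUp n w' := by
  have : ∀ {w w' : ℕ → ℕ → SetEntry}, (∀ m i, i < n m → w m i = w' m i) →
      systemUp n w ⊆ systemUp n w' := by
    rintro w w' h p ⟨m, i, hi, rfl⟩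
    exact ⟨m, i, hi, by rw [nodeDomino_congr h hi, h m i hi]⟩
  exact (this h).antisymm (this fun m i hi => (h m i hi).symm)

/-- The filled dominoes determine the entries: on each station both systems list the same dominoes
in increasing order. -/
theorem eq_of_systemUp_eq {n : ℕ → ℕ} {w w' : ℕ → ℕ → SetEntry} (h : IsDiagonalSystem n w)
    (h' : IsDiagonalSystem n w') (he : systemUp n w = systemUp n w') {m i : ℕ} (hi : i < n m) :
    w m i = w' m i := by
  -- every node of station `m` of the first system is a node of station `m` of the second one
  have hex : ∀ {w w'}, IsDiagonalSystem n w → IsDiagonalSystem n w' →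
      systemUp n w = systemUp n w' → ∀ i < n m, ∃ i' < n m,
        nodeDomino n w m i = nodeDomino n w' m i' ∧ w m i = w' m i' := by
    intro w w' h h' he i hi
    have hmem : (nodeDomino n w m i, w m i) ∈ systemUp n w := ⟨m, i, hi, rfl⟩
    rw [he] at hmem
    obtain ⟨m', i', hi', heq⟩ := hmem
    obtain ⟨h1, h2⟩ := Prod.mk.inj heq
    have hs := congrArg Domino.station h1
    rw [station_nodeDomino, station_nodeDomino] at hs
    obtain rfl : m = m' := by exact_mod_cast hs
    exact ⟨i', hi', h1, h2⟩
  choose! f hf hfd hfw using hex h h' he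
  -- the resulting matching of indices is strictly increasing, hence the identity
  have hmono : ∀ i i', i < i' → i' < n m → f i < f i' := by
    intro i i' hlt hi'
    by_contra hge
    have h1 := h.evenCell_nodeDomino_lt hlt hi'
    rw [hfd i (hlt.trans hi'), hfd i' hi'] at h1
    rcases (not_lt.1 hge).lt_or_eq with h2 | h2
    · exact lt_asymm h1 (h'.evenCell_nodeDomino_lt h2 (hf i (hlt.trans hi')))
    · rw [h2] at h1
      exact lt_irrefl _ h1
  have hge : ∀ i < n m, i ≤ f i := by
    intro i
    induction i with
    | zero => exact fun _ => Nat.zero_le _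
    | succ i ih =>
      intro hi
      have h1 := ih (by omega)
      have h2 := hmono i (i + 1) (Nat.lt_succ_self i) hi
      omega
  have hle : ∀ d i, i + d + 1 = n m → f i ≤ i := by
    intro d
    induction d with
    | zero =>
      intro i hi
      have := hf i (by omega)
      omega
    | succ d ih =>
      intro i hi
      have h1 := ih (i + 1) (by omega)
      have h2 := hmono i (i + 1) (Nat.lt_succ_self i) (by omega)
      omega
  have hfi : f i = i := le_antisymm (hle (n m - i - 1) i (by omega)) (hge i hi)
  rw [hfw i hi, hfi]

theorem isDiagonalWord_of_up_eq {lam : YoungDiagram} {T : ShiftedSetDominoTableau lam}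
    {n : ℕ → ℕ} {w : ℕ → ℕ → SetEntry} (h : IsDiagonalSystem n w) (hT : T.up = systemUp n w)
    {τ : DominoType} {k m : ℕ}
    (hm : ∀ d : Domino, d.type = τ ∧ d.diagonal = (k : ℤ) ↔ d.station = m) :
    T.IsDiagonalWord τ k ((List.range (n m)).map (w m)) := by
  have hup : ∀ {m i}, i < n m → (nodeDomino n w m i, w m i) ∈ T.up := fun hi => by
    rw [hT]; exact ⟨_, _, hi, rfl⟩
  refine ⟨(List.range (n m)).map (nodeDomino n w m), ?_, ?_, ?_⟩
  · rw [List.pairwise_map]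
    exact List.pairwise_lt_range.imp_of_mem fun _ hb hab =>
      h.evenCell_nodeDomino_lt hab (List.mem_range.1 hb)
  · intro d
    rw [List.mem_map, hm]
    constructor
    · rintro ⟨i, hi, rfl⟩
      exact ⟨(hup (List.mem_range.1 hi)).1, station_nodeDomino m i⟩
    · rintro ⟨hd, hs⟩
      have hs0 : 0 ≤ d.station := by omega
      have hmem : (d, T.entry d) ∈ T.up :=
        ⟨hd, Domino.diagonal_nonneg_iff.2 hs0, T.fill_eq_some_entry hd hs0⟩
      rw [hT] at hmem
      obtain ⟨m', i, hi, heq⟩ := hmem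
      obtain ⟨rfl, -⟩ := Prod.mk.inj heq
      rw [station_nodeDomino] at hs
      obtain rfl : m' = m := by exact_mod_cast hs
      exact ⟨i, List.mem_range.2 hi, rfl⟩
  · rw [List.map_map, List.map_map]
    exact List.map_congr_left fun i hi => (hup (List.mem_range.1 hi)).2.2

section Pair

variable {σ₁ σ₂ : YoungDiagram}

/-- The lengths of the stations for a pair of shapes: the even stations are the diagonals of the
first shape, the odd ones those of the second. -/
def pairLen (σ₁ σ₂ : YoungDiagram) (m : ℕ) : ℕ :=
  if m % 2 = 0 then diagLen σ₁ (m / 2) else diagLen σ₂ (m / 2)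

/-- The entries of the stations for a pair of tableaux. -/
noncomputable def pairEntry (t : ShiftedSetTableau σ₁ × ShiftedSetTableau σ₂) (m i : ℕ) :
    SetEntry :=
  if m % 2 = 0 then t.1.entry (m / 2) i else t.2.entry (m / 2) i

theorem pairLen_even (k : ℕ) : pairLen σ₁ σ₂ (2 * k) = diagLen σ₁ k := by
  rw [pairLen, if_pos (by omega), show 2 * k / 2 = k by omega]

theorem pairLen_odd (k : ℕ) : pairLen σ₁ σ₂ (2 * k + 1) = diagLen σ₂ k := by
  rw [pairLen, if_neg (by omega), show (2 * k + 1) / 2 = k by omega]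

theorem pairEntry_even (t : ShiftedSetTableau σ₁ × ShiftedSetTableau σ₂) (k : ℕ) :
    pairEntry t (2 * k) = t.1.entry k := by
  funext i
  rw [pairEntry, if_pos (by omega), show 2 * k / 2 = k by omega]

theorem pairEntry_odd (t : ShiftedSetTableau σ₁ × ShiftedSetTableau σ₂) (k : ℕ) :
    pairEntry t (2 * k + 1) = t.2.entry k := by
  funext i
  rw [pairEntry, if_neg (by omega), show (2 * k + 1) / 2 = k by omega]

theorem isDiagonalSystem_pair (t : ShiftedSetTableau σ₁ × ShiftedSetTableau σ₂) :
    IsDiagonalSystem (pairLen σ₁ σ₂) (pairEntry t) := by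
  constructor <;> intro m <;> obtain ⟨k, rfl | rfl⟩ := Nat.even_or_odd' m
  · rw [show 2 * k + 2 = 2 * (k + 1) by ring, pairLen_even, pairLen_even]
    exact diagLen_succ_le _ _
  · rw [show 2 * k + 1 + 2 = 2 * (k + 1) + 1 by ring, pairLen_odd, pairLen_odd]
    exact diagLen_succ_le _ _
  · rw [show 2 * k + 2 = 2 * (k + 1) by ring, pairLen_even, pairLen_even]
    exact diagLen_le_succ _ _
  · rw [show 2 * k + 1 + 2 = 2 * (k + 1) + 1 by ring, pairLen_odd, pairLen_odd]
    exact diagLen_le_succ _ _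
  · intro i hi
    rw [show 2 * k + 2 = 2 * (k + 1) by ring] at hi ⊢
    rw [pairLen_even] at hi
    rw [pairEntry_even, pairEntry_even]
    exact t.1.eastOK hi
  · intro i hi
    rw [show 2 * k + 1 + 2 = 2 * (k + 1) + 1 by ring] at hi ⊢
    rw [pairLen_odd] at hi
    rw [pairEntry_odd, pairEntry_odd]
    exact t.2.eastOK hi
  · intro i hi
    rw [show 2 * k + 2 = 2 * (k + 1) by ring]
    rw [pairLen_even] at hi
    rw [pairEntry_even, pairEntry_even]
    exact t.1.southOK hi
  · intro i hi
    rw [show 2 * k + 1 + 2 = 2 * (k + 1) + 1 by ring]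
    rw [pairLen_odd] at hi
    rw [pairEntry_odd, pairEntry_odd]
    exact t.2.southOK hi

theorem exists_pair_of_system {w : ℕ → ℕ → SetEntry}
    (h : IsDiagonalSystem (pairLen σ₁ σ₂) w) :
    ∃ t : ShiftedSetTableau σ₁ × ShiftedSetTableau σ₂,
      ∀ m i, i < pairLen σ₁ σ₂ m → w m i = pairEntry t m i := by
  obtain ⟨t₁, ht₁⟩ := ShiftedSetTableau.exists_entry_eq (μ := σ₁) (fun k => w (2 * k))
    (fun k i hi => h.east (2 * k) i ((pairLen_even (σ₂ := σ₂) (k + 1)).symm ▸ hi))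
    (fun k i hi => h.south (2 * k) i ((pairLen_even (σ₂ := σ₂) k).symm ▸ hi))
  obtain ⟨t₂, ht₂⟩ := ShiftedSetTableau.exists_entry_eq (μ := σ₂) (fun k => w (2 * k + 1))
    (fun k i hi => h.east (2 * k + 1) i ((pairLen_odd (σ₁ := σ₁) (k + 1)).symm ▸ hi))
    (fun k i hi => h.south (2 * k + 1) i ((pairLen_odd (σ₁ := σ₁) k).symm ▸ hi))
  refine ⟨(t₁, t₂), fun m i hi => ?_⟩
  obtain ⟨k, rfl | rfl⟩ := Nat.even_or_odd' m
  · rw [pairLen_even] at hi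
    rw [pairEntry_even, ht₁ k i hi]
  · rw [pairLen_odd] at hi
    rw [pairEntry_odd, ht₂ k i hi]

theorem pair_eq_of_systemUp_eq {t t' : ShiftedSetTableau σ₁ × ShiftedSetTableau σ₂}
    (h : systemUp (pairLen σ₁ σ₂) (pairEntry t) = systemUp (pairLen σ₁ σ₂) (pairEntry t')) :
    t = t' := by
  have he : ∀ {m i}, i < pairLen σ₁ σ₂ m → pairEntry t m i = pairEntry t' m i := fun hi =>
    eq_of_systemUp_eq (isDiagonalSystem_pair t) (isDiagonalSystem_pair t') h hi
  refine Prod.ext (ShiftedSetTableau.ext_entry fun k i hi => ?_)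
    (ShiftedSetTableau.ext_entry fun k i hi => ?_)
  · have := he (m := 2 * k) (i := i) (by rwa [pairLen_even])
    rwa [pairEntry_even, pairEntry_even] at this
  · have := he (m := 2 * k + 1) (i := i) (by rwa [pairLen_odd])
    rwa [pairEntry_odd, pairEntry_odd] at this

/-- The bijection for shapes whose diagonals are as long as the stations of the shifted pavings. -/
theorem exists_equiv {lam : YoungDiagram} (hlam : IsShiftedPavable lam)
    (h₁ : ∀ P, IsPaving lam P → ∀ k : ℕ, diagLen σ₁ k = stationCount P (2 * k : ℕ))
    (h₂ : ∀ P, IsPaving lam P → ∀ k : ℕ, diagLen σ₂ k = stationCount P (2 * k + 1 : ℕ)) :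
    ∃ Γ : Quotient (upSetoid lam) ≃ ShiftedSetTableau σ₁ × ShiftedSetTableau σ₂,
      ∀ (T : ShiftedSetDominoTableau lam) (k : ℕ),
        T.IsDiagonalWord DominoType.one k
          ((Γ (Quotient.mk (upSetoid lam) T)).1.diagonalWord k) ∧
        T.IsDiagonalWord DominoType.two k
          ((Γ (Quotient.mk (upSetoid lam) T)).2.diagonalWord k) := by
  have hn : ∀ P, IsPaving lam P → ∀ m : ℕ, pairLen σ₁ σ₂ m = stationCount P m := by
    intro P hP m
    obtain ⟨k, rfl | rfl⟩ := Nat.even_or_odd' m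
    · rw [pairLen_even, h₁ P hP]
    · rw [pairLen_odd, h₂ P hP]
  obtain ⟨P₀, hP₀⟩ := hlam
  choose S hS using fun t : ShiftedSetTableau σ₁ × ShiftedSetTableau σ₂ =>
    (isDiagonalSystem_pair t).exists_tableau hP₀ (hn P₀ hP₀.paving)
  have hbij : Function.Bijective fun t => Quotient.mk (upSetoid lam) (S t) := by
    constructor
    · intro t t' h
      have hup : (S t).up = (S t').up := Quotient.exact h
      rw [hS, hS] at hup
      exact pair_eq_of_systemUp_eq hup
    · intro q
      obtain ⟨T, rfl⟩ := Quotient.exists_rep q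
      obtain ⟨w, hw, hT⟩ := T.exists_system (hn T.paving T.isPaving)
      obtain ⟨t, ht⟩ := exists_pair_of_system hw
      refine ⟨t, Quotient.sound ?_⟩
      change (S t).up = T.up
      rw [hS, hT, systemUp_congr ht]
  refine ⟨(Equiv.ofBijective _ hbij).symm, fun T k => ?_⟩
  set t := (Equiv.ofBijective _ hbij).symm (Quotient.mk (upSetoid lam) T) with ht
  have hT : T.up = systemUp (pairLen σ₁ σ₂) (pairEntry t) := by
    have h : Quotient.mk (upSetoid lam) (S t) = Quotient.mk (upSetoid lam) T :=
      (Equiv.ofBijective _ hbij).apply_symm_apply _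
    have hup : (S t).up = T.up := Quotient.exact h
    rw [← hup, hS]
  have hsys := isDiagonalSystem_pair t
  constructor
  · have := isDiagonalWord_of_up_eq hsys hT (τ := DominoType.one) (k := k) (m := 2 * k)
      (fun d => by rw [Domino.type_eq_one_iff, Domino.diagonal_eq]; push_cast; omega)
    rwa [pairLen_even, pairEntry_even, ← ShiftedSetTableau.diagonalWord_eq] at this
  · have := isDiagonalWord_of_up_eq hsys hT (τ := DominoType.two) (k := k) (m := 2 * k + 1)
      (fun d => by rw [Domino.type_eq_two_iff, Domino.diagonal_eq]; push_cast; omega)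
    rwa [pairLen_odd, pairEntry_odd, ← ShiftedSetTableau.diagonalWord_eq] at this

end Pair

end ShiftedDomino

theorem mainTheorem3 (lam mu nu : YoungDiagram)
    (hlam : ShiftedDomino.IsShiftedPavable lam)
    (hquot : ShiftedDomino.IsTwoQuotient lam mu nu) :
    ∃ Γ : Quotient (ShiftedDomino.upSetoid lam) ≃
        ShiftedDomino.ShiftedSetTableau mu × ShiftedDomino.ShiftedSetTableau nu,
      ∀ (T : ShiftedDomino.ShiftedSetDominoTableau lam) (k : ℕ),
        T.IsDiagonalWord (ShiftedDomino.fstType lam) k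
          ((Γ (Quotient.mk (ShiftedDomino.upSetoid lam) T)).1.diagonalWord k) ∧
        T.IsDiagonalWord (ShiftedDomino.sndType lam) k
          ((Γ (Quotient.mk (ShiftedDomino.upSetoid lam) T)).2.diagonalWord k) := by
  obtain ⟨hmu, hnu⟩ := hquot
  rw [ShiftedDomino.fstType, ShiftedDomino.sndType]
  rcases Nat.mod_two_eq_zero_or_one lam.rowLens.length with hpar | hpar
  · rw [if_pos hpar, if_pos hpar]
    exact ShiftedDomino.exists_equiv hlam
      (fun P hP k => hP.diagLen_quotient (s := 0) hmu (by omega) k)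
      (fun P hP k => hP.diagLen_quotient (s := 1) hnu (by omega) k)
  · -- for an odd number of parts the two components of the 2-quotient change their roles
    rw [if_neg (by omega), if_neg (by omega)]
    obtain ⟨Γ, hΓ⟩ := ShiftedDomino.exists_equiv (σ₁ := nu) (σ₂ := mu) hlam
      (fun P hP k => hP.diagLen_quotient (s := 0) hnu (by omega) k)
      (fun P hP k => hP.diagLen_quotient (s := 1) hmu (by omega) k)
    exact ⟨Γ.trans (Equiv.prodComm _ _), fun T k => ⟨(hΓ T k).2, (hΓ T k).1⟩⟩
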